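/- Consider real solutions of the first Painlevé equation $y''=6y^2-x$, each taken on its interval of existence, i.e. the largest open interval $I\subseteq\mathbb R$ to which it extends as a real (pole-free) solution; solutions with different intervals of existence are considered different. A number $x_0$ is the right pole of a solution if it is the right endpoint of $I$ and the solution has a pole at $x_0$. For $x_0\le 0$ and $y_0>y_l$ let $x_{min}(x_0,y_0,y_l)<x_0$ denote the point at which the solution $y$ that is regular at $x_0$, satisfies $y(x_0)=y_0$, and has $y_l$ as its minimum value over $I\cap(-\infty,x_0]$, attains this minimum. Put $$\mathcal X_{min}(x_0,y_l)=\inf_{y_0>y_l}x_{min}(x_0,y_0,y_l).$$ **Theorem 3.1.** Every solution whose interval of existence is contained in $(-\infty,0]$ has a right pole $x_0\le 0$ and attains a minimum value $y_l\in\mathbb R$ on its interval of existence, and it is uniquely determined by the pair $(x_0,y_l)$: for every $x_0\le0$ and every $y_l\in\mathbb R$ there is exactly one solution with interval of existence contained in $(-\infty,0]$, right pole $x_0$ and minimum value $y_l$. Moreover, $\mathcal X_{min}(x_0,y_l)$ is finite, and this solution attains its minimum value at $\mathcal X_{min}(x_0,y_l)$ and nowhere else. -/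

import Mathlib

open Set Filter Topology

/-- `y` satisfies the first Painlevé equation `y'' = 6 y² - x` at every point of the open set `I`
(it is twice differentiable there). Values of `y` outside `I` are irrelevant. -/
def SolvesP1On (I : Set ℝ) (y : ℝ → ℝ) : Prop :=
  ∀ x ∈ I, DifferentiableAt ℝ y x ∧ HasDerivAt (deriv y) (6 * y x ^ 2 - x) x

/-- A real solution of the first Painlevé equation together with its interval of existence `I`:
a nonempty open interval on which `y` solves the equation, and to no larger open interval can
`y` be continued as a solution. -/
structure IsP1Solution (I : Set ℝ) (y : ℝ → ℝ) : Prop where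
  isOpen : IsOpen I
  isConnected : IsConnected I
  solves : SolvesP1On I y
  maximal : ∀ (J : Set ℝ) (z : ℝ → ℝ), IsOpen J → IsConnected J → I ⊆ J →
    SolvesP1On J z → EqOn y z I → J = I

/-- `x₀` is the right pole of the solution `y` with interval of existence `I`: it is the right
endpoint of `I`, and to the left of `x₀` the function `y` agrees with a (real) meromorphic
germ at `x₀` that has a pole at `x₀`. -/
def IsRightPole (I : Set ℝ) (y : ℝ → ℝ) (x₀ : ℝ) : Prop :=
  IsLUB I x₀ ∧ ∃ g : ℝ → ℝ, MeromorphicAt g x₀ ∧ meromorphicOrderAt g x₀ < 0 ∧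
    y =ᶠ[𝓝[<] x₀] g

/-- `m` is a value of `x_min(x₀, y₀, y_l)`: some solution regular at `x₀` has the value `y₀` at
`x₀`, and its minimum to the left of `x₀` has the value `y_l` and is attained at `m < x₀`. -/
def IsXmin (x₀ y₀ yl m : ℝ) : Prop :=
  ∃ (I : Set ℝ) (y : ℝ → ℝ), IsP1Solution I y ∧ x₀ ∈ I ∧ y x₀ = y₀ ∧
    m ∈ I ∧ m < x₀ ∧ y m = yl ∧ ∀ x ∈ I, x ≤ x₀ → yl ≤ y x

/-- All values `x_min(x₀, y₀, y_l)` with `y₀ > y_l`. -/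
def xminValues (x₀ yl : ℝ) : Set ℝ := {m | ∃ y₀ > yl, IsXmin x₀ y₀ yl m}

/-- `𝒳_min(x₀, y_l) = inf_{y₀ > y_l} x_min(x₀, y₀, y_l)`. -/
noncomputable def calXmin (x₀ yl : ℝ) : ℝ := sInf (xminValues x₀ yl)

/-!
On `(-∞, 0]` every solution is strictly convex, so a solution living there has exactly one critical
point `m`, and its phase `(y m, y' m) = (y_l, 0)` at `m` determines it. Compare the solutions with
minimum value `y_l`, parametrized by `m`: since the forcing term `-x` decreases, the solution with
the smaller `m`, shifted so that the minima coincide, stays above the other one (at a first crossing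
the energies `y'²/2 - 2y³ + xy`, whose derivatives are `y`, would force the wrong order of slopes).
It lives no longer beyond its minimum, so the right pole is a strictly increasing function of `m`;
continuous dependence on `m` and blow-up estimates make it continuous, hence it takes every value
`x₀ ≤ 0`. The solutions regular at `x₀` are those with `m` beyond the one whose pole is `x₀`, which
identifies the infimum.

That the blow-up is a pole follows by passing to coordinates `(u, v)` with `y = u⁻²` in which the
equation extends holomorphically across `u = 0`. The energy is `O(y)` near the blow-up, so `v` has a
limit there, and Cauchy's existence theorem continues `u` analytically past it.
-/

section FirstOrderSystem

variable {E : Type*} [NormedAddCommGroup E] [NormedSpace ℝ E] {F : ℝ → E → E}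

lemma eventuallyEq_of_hasDerivAt_of_eq (hF : ContDiff ℝ 1 (Function.uncurry F)) {f g : ℝ → E}
    {t₀ : ℝ} (hf : ∀ᶠ t in 𝓝 t₀, HasDerivAt f (F t (f t)) t)
    (hg : ∀ᶠ t in 𝓝 t₀, HasDerivAt g (F t (g t)) t) (h : f t₀ = g t₀) : f =ᶠ[𝓝 t₀] g := by
  obtain ⟨K, S, hS, hK⟩ := (hF.contDiffAt (x := (t₀, f t₀))).exists_lipschitzOnWith
  have graph_mem : ∀ u : ℝ → E, (∀ᶠ t in 𝓝 t₀, HasDerivAt u (F t (u t)) t) → u t₀ = f t₀ →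
      ∀ᶠ t in 𝓝 t₀, (t, u t) ∈ S := fun u hu hu₀ =>
    (continuousAt_id.prodMk hu.self_of_nhds.continuousAt).preimage_mem_nhds (by rwa [id, hu₀])
  refine ODE_solution_unique_of_eventually (K := K * 1) (s := fun t => Prod.mk t ⁻¹' S)
    (Eventually.of_forall fun t => ?_) (hf.and (graph_mem f hf rfl))
    (hg.and (graph_mem g hg h.symm)) h
  exact hK.comp (LipschitzWith.prodMk_left t).lipschitzOnWith (mapsTo_preimage _ _)

lemma eqOn_of_hasDerivAt_of_eq (hF : ContDiff ℝ 1 (Function.uncurry F)) {I : Set ℝ}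
    (hI : IsOpen I) (hI' : IsPreconnected I) {f g : ℝ → E}
    (hf : ∀ t ∈ I, HasDerivAt f (F t (f t)) t) (hg : ∀ t ∈ I, HasDerivAt g (F t (g t)) t)
    {t₀ : ℝ} (ht₀ : t₀ ∈ I) (h : f t₀ = g t₀) : EqOn f g I := by
  have eventuallyEq_of_eq : ∀ t ∈ I, f t = g t → f =ᶠ[𝓝 t] g := fun t ht hfg =>
    eventuallyEq_of_hasDerivAt_of_eq hF (eventually_of_mem (hI.mem_nhds ht) hf)
      (eventually_of_mem (hI.mem_nhds ht) hg) hfg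
  suffices I ⊆ {t | f =ᶠ[𝓝 t] g} from fun t ht => (this ht).self_of_nhds
  refine hI'.subset_of_closure_inter_subset isOpen_setOfPred_eventually_nhds
    ⟨t₀, ht₀, eventuallyEq_of_eq t₀ ht₀ h⟩ fun t ⟨ht, htI⟩ => eventuallyEq_of_eq t htI ?_
  have : (𝓝[{t | f =ᶠ[𝓝 t] g}] t).NeBot := mem_closure_iff_nhdsWithin_neBot.1 ht
  refine tendsto_nhds_unique_of_eventuallyEq (l := 𝓝[{t | f =ᶠ[𝓝 t] g}] t)
    ((hf t htI).continuousAt.mono_left nhdsWithin_le_nhds)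
    ((hg t htI).continuousAt.mono_left nhdsWithin_le_nhds)
    ?_
  filter_upwards [self_mem_nhdsWithin] with s hs using hs.self_of_nhds

/-- An integral curve of the autonomized field `(1, F)` keeps time up to a shift, so its second
component solves the original system. -/
lemma hasDerivAt_snd_of_autonomous {ε t₀ : ℝ} {α : ℝ → ℝ × E}
    (hα₀ : (α 0).1 = t₀)
    (hα : ∀ s ∈ Ioo (-ε) ε, HasDerivAt α (1, F (α s).1 (α s).2) s) {t : ℝ}
    (ht : t - t₀ ∈ Ioo (-ε) ε) :
    HasDerivAt (fun t => (α (t - t₀)).2) (F t (α (t - t₀)).2) t := by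
  have hε : (0 : ℝ) ∈ Ioo (-ε) ε := by constructor <;> linarith [ht.1, ht.2]
  have time_sub : ∀ s ∈ Ioo (-ε) ε, HasDerivAt (fun s => (α s).1 - s) 0 s := fun s hs => by
    have h : HasDerivAt (fun s => (α s).1) 1 s := (hα s hs).fst
    simpa using h.fun_sub (hasDerivAt_id' s)
  have time_eq := isOpen_Ioo.is_const_of_deriv_eq_zero isPreconnected_Ioo
    (fun s hs => (time_sub s hs).differentiableAt.differentiableWithinAt)
    (fun s hs => (time_sub s hs).deriv) ht hε
  have h : HasDerivAt (fun s => (α s).2) (F (α (t - t₀)).1 (α (t - t₀)).2) (t - t₀) :=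
    (hα _ ht).snd
  rw [show (α (t - t₀)).1 = t by linarith] at h
  exact h.comp_sub_const t t₀

lemma exists_local_flow [CompleteSpace E] (hF : ContDiff ℝ 1 (Function.uncurry F)) (τ : ℝ)
    (L : E) :
    ∃ ε > 0, ∃ V ∈ 𝓝 L, ∃ Φ : ℝ × E → ℝ → E,
      (∀ t₀ ∈ Metric.ball τ ε, ∀ Y₀ ∈ V, Φ (t₀, Y₀) t₀ = Y₀ ∧
        ∀ t ∈ Metric.ball τ ε, HasDerivAt (Φ (t₀, Y₀)) (F t (Φ (t₀, Y₀) t)) t) ∧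
      ∀ t ∈ Metric.ball τ ε, ContinuousOn (Φ · t) (Metric.ball τ ε ×ˢ V) := by
  have hf : ContDiffAt ℝ 1 (fun X : ℝ × E => ((1 : ℝ), F X.1 X.2)) (τ, L) :=
    contDiffAt_const.prodMk hF.contDiffAt
  obtain ⟨ε, hε, a, r, _, _, hr, hpl⟩ := IsPicardLindelof.of_contDiffAt_one hf
  obtain ⟨α, hα, hαc⟩ := (hpl 0).exists_forall_mem_closedBall_eq_hasDerivWithinAt_continuousOn
  simp only [zero_sub, zero_add] at hα hαc
  have hδ : 0 < min (r : ℝ) (ε / 2) := lt_min hr (half_pos hε)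
  have mem_ball : ∀ t₀ ∈ Metric.ball τ (min (r : ℝ) (ε / 2)), ∀ Y₀ ∈ Metric.closedBall L r,
      (t₀, Y₀) ∈ Metric.closedBall (τ, L) (r : ℝ) := fun t₀ ht₀ Y₀ hY₀ => by
    rw [← closedBall_prod_same]
    exact ⟨Metric.ball_subset_closedBall (Metric.ball_subset_ball (min_le_left _ _) ht₀), hY₀⟩
  have sub_mem : ∀ t₀ ∈ Metric.ball τ (min (r : ℝ) (ε / 2)),
      ∀ t ∈ Metric.ball τ (min (r : ℝ) (ε / 2)), t - t₀ ∈ Ioo (-ε) ε := fun t₀ ht₀ t ht => by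
    rw [Metric.mem_ball, lt_min_iff, Real.dist_eq] at ht₀ ht
    obtain ⟨ht₀l, ht₀r⟩ := abs_lt.1 ht₀.2
    obtain ⟨htl, htr⟩ := abs_lt.1 ht.2
    constructor <;> linarith
  refine ⟨_, hδ, _, Metric.closedBall_mem_nhds L hr, fun X t => (α (X, t - X.1)).2,
    fun t₀ ht₀ Y₀ hY₀ => ⟨?_, fun t ht => ?_⟩, fun t ht => ?_⟩
  · simp [(hα _ (mem_ball t₀ ht₀ Y₀ hY₀)).1]
  · obtain ⟨h₀, h⟩ := hα _ (mem_ball t₀ ht₀ Y₀ hY₀)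
    exact hasDerivAt_snd_of_autonomous (congrArg Prod.fst h₀)
      (fun s hs => (h s (Ioo_subset_Icc_self hs)).hasDerivAt (Icc_mem_nhds hs.1 hs.2))
      (sub_mem t₀ ht₀ t ht)
  · refine continuous_snd.comp_continuousOn (hαc.comp (by fun_prop) fun X hX => ?_)
    exact ⟨mem_ball _ hX.1 _ hX.2, Ioo_subset_Icc_self (sub_mem _ hX.1 _ ht)⟩

end FirstOrderSystem

section PhaseSpace

variable {I J : Set ℝ} {y z : ℝ → ℝ} {x : ℝ}

/-- The first Painlevé equation as a first-order system for `(y, y')`. -/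
def p1Field (x : ℝ) (Y : ℝ × ℝ) : ℝ × ℝ := (Y.2, 6 * Y.1 ^ 2 - x)

/-- The curve `(y, y')` in the phase plane. -/
noncomputable def phase (y : ℝ → ℝ) (x : ℝ) : ℝ × ℝ := (y x, deriv y x)

lemma contDiff_p1Field : ContDiff ℝ 1 (Function.uncurry p1Field) := by
  unfold p1Field Function.uncurry; fun_prop

lemma SolvesP1On.hasDerivAt (h : SolvesP1On I y) (hx : x ∈ I) : HasDerivAt y (deriv y x) x :=
  (h x hx).1.hasDerivAt

lemma SolvesP1On.hasDerivAt_phase (h : SolvesP1On I y) (hx : x ∈ I) :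
    HasDerivAt (phase y) (p1Field x (phase y x)) x :=
  (h.hasDerivAt hx).prodMk (h x hx).2

lemma SolvesP1On.continuousOn_phase (h : SolvesP1On I y) : ContinuousOn (phase y) I :=
  HasDerivAt.continuousOn fun _ hx => h.hasDerivAt_phase hx

lemma SolvesP1On.continuousOn (h : SolvesP1On I y) : ContinuousOn y I :=
  HasDerivAt.continuousOn fun _ hx => h.hasDerivAt hx

lemma SolvesP1On.continuousOn_deriv (h : SolvesP1On I y) : ContinuousOn (deriv y) I :=
  HasDerivAt.continuousOn fun x hx => (h x hx).2

lemma SolvesP1On.congr (hI : IsOpen I) (h : SolvesP1On I y) (hyz : EqOn z y I) :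
    SolvesP1On I z := by
  intro x hx
  have hx' : z =ᶠ[𝓝 x] y := hyz.eventuallyEq_of_mem (hI.mem_nhds hx)
  refine ⟨hx'.differentiableAt_iff.2 (h x hx).1, ?_⟩
  rw [hx'.eq_of_nhds]
  exact (h x hx).2.congr_of_eventuallyEq hx'.deriv

lemma phase_eq_of_eqOn (hI : IsOpen I) (hyz : EqOn z y I) (hx : x ∈ I) : phase z x = phase y x := by
  have hx' : z =ᶠ[𝓝 x] y := hyz.eventuallyEq_of_mem (hI.mem_nhds hx)
  exact Prod.ext hx'.eq_of_nhds hx'.deriv_eq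

lemma solvesP1On_of_curve (hI : IsOpen I) {α : ℝ → ℝ × ℝ}
    (h : ∀ t ∈ I, HasDerivAt α (p1Field t (α t)) t) :
    SolvesP1On I (fun t => (α t).1) ∧ ∀ t ∈ I, phase (fun t => (α t).1) t = α t := by
  have hfst : ∀ t ∈ I, HasDerivAt (fun t => (α t).1) (α t).2 t := fun t ht => (h t ht).fst
  have hsnd : ∀ t ∈ I, HasDerivAt (fun t => (α t).2) (6 * (α t).1 ^ 2 - t) t :=
    fun t ht => (h t ht).snd
  refine ⟨fun t ht => ⟨(hfst t ht).differentiableAt, ?_⟩,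
    fun t ht => Prod.ext rfl (hfst t ht).deriv⟩
  refine (hsnd t ht).congr_of_eventuallyEq ?_
  filter_upwards [hI.mem_nhds ht] with s hs using (hfst s hs).deriv

lemma SolvesP1On.eqOn_inter (hI : IsOpen I) (hI' : IsPreconnected I)
    (hJ : IsOpen J) (hJ' : IsPreconnected J) (hy : SolvesP1On I y) (hz : SolvesP1On J z)
    (hxI : x ∈ I) (hxJ : x ∈ J) (h : phase y x = phase z x) : EqOn y z (I ∩ J) := by
  have hphase : EqOn (phase y) (phase z) (I ∩ J) :=
    eqOn_of_hasDerivAt_of_eq contDiff_p1Field (hI.inter hJ)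
      (hI'.ordConnected.inter hJ'.ordConnected).isPreconnected
      (fun _ ht => hy.hasDerivAt_phase ht.1) (fun _ ht => hz.hasDerivAt_phase ht.2) ⟨hxI, hxJ⟩ h
  exact fun t ht => congrArg Prod.fst (hphase ht)

lemma exists_solvesP1On_iUnion {ι : Type*} {I : ι → Set ℝ} {y : ι → ℝ → ℝ}
    (hI : ∀ i, IsOpen (I i)) (h : ∀ i, SolvesP1On (I i) (y i))
    (hagree : ∀ i j, EqOn (y i) (y j) (I i ∩ I j)) :
    ∃ w, SolvesP1On (⋃ i, I i) w ∧ ∀ i, EqOn w (y i) (I i) := by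
  have exists_common_value : ∀ x, ∃ v, ∀ i, x ∈ I i → v = y i x := by
    intro x
    by_cases hx : ∃ i, x ∈ I i
    · obtain ⟨i, hi⟩ := hx
      exact ⟨y i x, fun j hj => hagree i j ⟨hi, hj⟩⟩
    · exact ⟨0, fun i hi => (hx ⟨i, hi⟩).elim⟩
  choose w hw using exists_common_value
  have hw' : ∀ i, EqOn w (y i) (I i) := fun i x hx => hw x i hx
  refine ⟨w, fun x hx => ?_, hw'⟩
  obtain ⟨i, hi⟩ := mem_iUnion.1 hx
  exact (h i).congr (hI i) (hw' i) x hi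

lemma exists_isP1Solution (x₀ : ℝ) (Y₀ : ℝ × ℝ) :
    ∃ (I : Set ℝ) (y : ℝ → ℝ), IsP1Solution I y ∧ x₀ ∈ I ∧ phase y x₀ = Y₀ := by
  let S := {p : Set ℝ × (ℝ → ℝ) // IsOpen p.1 ∧ IsPreconnected p.1 ∧ x₀ ∈ p.1 ∧
    SolvesP1On p.1 p.2 ∧ phase p.2 x₀ = Y₀}
  have hagree : ∀ p q : S, EqOn p.1.2 q.1.2 (p.1.1 ∩ q.1.1) := by
    rintro ⟨p, hp, hp', hxp, hps, hp₀⟩ ⟨q, hq, hq', hxq, hqs, hq₀⟩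
    exact hps.eqOn_inter hp hp' hq hq' hqs hxp hxq (hp₀.trans hq₀.symm)
  obtain ⟨y, hy, hyp⟩ := exists_solvesP1On_iUnion (fun p : S => p.2.1) (fun p => p.2.2.2.2.1) hagree
  set I : Set ℝ := ⋃ p : S, p.1.1
  have hI : IsOpen I := isOpen_iUnion fun p => p.2.1
  have hI' : IsPreconnected I :=
    isPreconnected_iUnion ⟨x₀, mem_iInter.2 fun p => p.2.2.2.1⟩ fun p => p.2.2.1
  obtain ⟨ε, hε, V, hV, Φ, hΦ, -⟩ := exists_local_flow contDiff_p1Field x₀ Y₀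
  have hx₀ball := Metric.mem_ball_self (x := x₀) hε
  obtain ⟨hΦ₀, hΦ'⟩ := hΦ x₀ hx₀ball Y₀ (mem_of_mem_nhds hV)
  obtain ⟨hzs, hz⟩ := solvesP1On_of_curve Metric.isOpen_ball hΦ'
  let p₀ : S := ⟨(Metric.ball x₀ ε, _), Metric.isOpen_ball,
    (convex_ball x₀ ε).isPreconnected, hx₀ball, hzs, (hz x₀ hx₀ball).trans hΦ₀⟩
  have hx₀ : x₀ ∈ I := mem_iUnion.2 ⟨p₀, hx₀ball⟩
  have hphase : phase y x₀ = Y₀ :=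
    (phase_eq_of_eqOn p₀.2.1 (hyp p₀) hx₀ball).trans p₀.2.2.2.2.2
  refine ⟨I, y, ⟨hI, ⟨⟨x₀, hx₀⟩, hI'⟩, hy, fun J w hJ hJ' hIJ hw hyw => ?_⟩, hx₀, hphase⟩
  let q : S := ⟨(J, w), hJ, hJ'.isPreconnected, hIJ hx₀, hw,
    (phase_eq_of_eqOn hI hyw hx₀).symm.trans hphase⟩
  exact (subset_iUnion (fun p : S => p.1.1) q).antisymm hIJ

lemma IsP1Solution.ordConnected (h : IsP1Solution I y) : I.OrdConnected :=
  h.isConnected.isPreconnected.ordConnected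

lemma IsP1Solution.subset_of_phase_eq (h : IsP1Solution I y) (hJ : IsOpen J)
    (hJ' : IsPreconnected J) (hz : SolvesP1On J z) (hxI : x ∈ I) (hxJ : x ∈ J)
    (hyz : phase y x = phase z x) : J ⊆ I := by
  have hagree : EqOn y z (I ∩ J) :=
    h.solves.eqOn_inter h.isOpen h.isConnected.isPreconnected hJ hJ' hz hxI hxJ hyz
  obtain ⟨w, hw, hw'⟩ := exists_solvesP1On_iUnion (I := fun b => cond b I J)
    (y := fun b => cond b y z) (Bool.forall_bool.2 ⟨hJ, h.isOpen⟩)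
    (Bool.forall_bool.2 ⟨hz, h.solves⟩) (by
      simp [Bool.forall_bool, inter_comm J I, hagree, hagree.symm, eqOn_refl])
  rw [← union_eq_iUnion] at hw
  have hIJ := h.maximal (I ∪ J) w (h.isOpen.union hJ)
    ⟨⟨x, Or.inl hxI⟩, h.isConnected.isPreconnected.union x hxI hxJ hJ'⟩ subset_union_left hw
    (hw' true).symm
  exact union_eq_left.1 hIJ

lemma IsP1Solution.eq_of_phase_eq (h : IsP1Solution I y) (h' : IsP1Solution J z) (hxI : x ∈ I)
    (hxJ : x ∈ J) (hyz : phase y x = phase z x) : I = J ∧ EqOn y z I := by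
  obtain rfl : I = J := Subset.antisymm
    (h'.subset_of_phase_eq h.isOpen h.isConnected.isPreconnected h.solves hxJ hxI hyz.symm)
    (h.subset_of_phase_eq h'.isOpen h'.isConnected.isPreconnected h'.solves hxI hxJ hyz)
  refine ⟨rfl, ?_⟩
  simpa using h.solves.eqOn_inter h.isOpen h.isConnected.isPreconnected h.isOpen
    h.isConnected.isPreconnected h'.solves hxI hxJ hyz

lemma exists_flow_eqOn_phase (τ : ℝ) (L : ℝ × ℝ) :
    ∃ ε > 0, ∃ V ∈ 𝓝 L, ∃ Φ : ℝ × ℝ × ℝ → ℝ → ℝ × ℝ,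
      (∀ t ∈ Metric.ball τ ε, ContinuousOn (Φ · t) (Metric.ball τ ε ×ˢ V)) ∧
      ∀ I y, IsP1Solution I y → ∀ t₀ ∈ I, t₀ ∈ Metric.ball τ ε → phase y t₀ ∈ V →
        Metric.ball τ ε ⊆ I ∧ EqOn (phase y) (Φ (t₀, phase y t₀)) (Metric.ball τ ε) := by
  obtain ⟨ε, hε, V, hV, Φ, hΦ, hΦc⟩ := exists_local_flow contDiff_p1Field τ L
  refine ⟨ε, hε, V, hV, Φ, hΦc, fun I y h t₀ ht₀I ht₀ hYV => ?_⟩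
  obtain ⟨hΦ₀, hΦ'⟩ := hΦ t₀ ht₀ (phase y t₀) hYV
  obtain ⟨hzs, hz⟩ := solvesP1On_of_curve Metric.isOpen_ball hΦ'
  have hpre : IsPreconnected (Metric.ball τ ε) := (convex_ball τ ε).isPreconnected
  have hsub : Metric.ball τ ε ⊆ I :=
    h.subset_of_phase_eq Metric.isOpen_ball hpre hzs ht₀I ht₀ ((hz t₀ ht₀).trans hΦ₀).symm
  exact ⟨hsub, eqOn_of_hasDerivAt_of_eq contDiff_p1Field Metric.isOpen_ball hpre
    (fun t ht => h.solves.hasDerivAt_phase (hsub ht)) hΦ' ht₀ hΦ₀.symm⟩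

theorem IsP1Solution.not_frequently_bounded (h : IsP1Solution I y) {τ : ℝ} (hτ : τ ∉ I) (R : ℝ) :
    ¬ ∃ᶠ t in 𝓝[I] τ, ‖phase y t‖ ≤ R := by
  intro hf
  obtain ⟨L, -, hL⟩ := (isCompact_closedBall (0 : ℝ × ℝ) R).exists_mapClusterPt_of_frequently
    (hf.mono fun t ht => mem_closedBall_zero_iff.2 ht)
  obtain ⟨ε, hε, V, hV, Φ, -, hΦ⟩ := exists_flow_eqOn_phase τ L
  have hnear : ∀ᶠ t in 𝓝[I] τ, t ∈ Metric.ball τ ε ∧ t ∈ I :=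
    inter_mem (mem_nhdsWithin_of_mem_nhds (Metric.ball_mem_nhds τ hε)) self_mem_nhdsWithin
  obtain ⟨t, htV, htε, htI⟩ := ((hL.frequently hV).and_eventually hnear).exists
  exact hτ ((hΦ I y h t htI htε htV).1 (Metric.mem_ball_self hε))

/-- The base points `t i` may vary: only they and the initial data there have to converge. -/
theorem IsP1Solution.tendsto_phase {ι : Type*} {l : Filter ι} {I : ι → Set ℝ} {y : ι → ℝ → ℝ}
    (hz : IsP1Solution J z) (hy : ∀ i, IsP1Solution (I i) (y i)) {t : ι → ℝ} {a b : ℝ}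
    (ha : a ∈ J) (hb : b ∈ J) (ht : Tendsto t l (𝓝 a)) (htI : ∀ᶠ i in l, t i ∈ I i)
    (hphase : Tendsto (fun i => phase (y i) (t i)) l (𝓝 (phase z a))) :
    (∀ᶠ i in l, b ∈ I i) ∧ Tendsto (fun i => phase (y i) b) l (𝓝 (phase z b)) := by
  let P : ℝ → ℝ → Prop := fun a b => ∀ t : ι → ℝ, Tendsto t l (𝓝 a) → (∀ᶠ i in l, t i ∈ I i) →
    Tendsto (fun i => phase (y i) (t i)) l (𝓝 (phase z a)) →
    (∀ᶠ i in l, b ∈ I i) ∧ Tendsto (fun i => phase (y i) b) l (𝓝 (phase z b))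
  suffices P a b from this t ht htI hphase
  refine hz.isConnected.isPreconnected.induction₂' P (fun τ hτ => ?_)
    (fun a b c _ _ _ hab hbc t ht htI hphase => ?_) ha hb
  · obtain ⟨ε, hε, V, hV, Φ, hΦc, hΦ⟩ := exists_flow_eqOn_phase τ (phase z τ)
    let near : Set ℝ := {a | a ∈ Metric.ball τ ε ∧ V ∈ 𝓝 (phase z a) ∧ a ∈ J}
    have hnear : ∀ᶠ a in 𝓝[J] τ, a ∈ near :=
      (eventually_nhdsWithin_of_eventually_nhds (Metric.ball_mem_nhds τ hε)).and
        (((hz.solves.continuousOn_phase τ hτ).eventually (eventually_mem_nhds_iff.2 hV)).and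
          self_mem_nhdsWithin)
    have hP : ∀ a ∈ near, ∀ b ∈ near, P a b := by
      rintro a ⟨haε, haV, haJ⟩ b ⟨hbε, -, -⟩ t ht htI hphase
      have hflow : ∀ᶠ i in l, b ∈ I i ∧ phase (y i) b = Φ (t i, phase (y i) (t i)) b := by
        filter_upwards [htI, ht (Metric.isOpen_ball.mem_nhds haε), hphase haV] with i hiI hiε hiV
        obtain ⟨hsub, heq⟩ := hΦ (I i) (y i) (hy i) (t i) hiI hiε hiV
        exact ⟨hsub hbε, heq hbε⟩
      refine ⟨hflow.mono fun i hi => hi.1, Tendsto.congr' (hflow.mono fun i hi => hi.2.symm) ?_⟩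
      rw [(hΦ J z hz a haJ haε (mem_of_mem_nhds haV)).2 hbε]
      exact ((hΦc b hbε).continuousAt (prod_mem_nhds (Metric.isOpen_ball.mem_nhds haε) haV)
        ).tendsto.comp (ht.prodMk_nhds hphase)
    have hτnear : τ ∈ near := hnear.self_of_nhdsWithin hτ
    filter_upwards [hnear] with a ha using ⟨hP τ hτnear a ha, hP a ha τ hτnear⟩
  · obtain ⟨hb, hphaseb⟩ := hab t ht htI hphase
    exact hbc (fun _ => b) tendsto_const_nhds hb hphaseb

end PhaseSpace

section Calculus

lemma monotoneOn_of_hasDerivAt_nonneg {g g' : ℝ → ℝ} {D : Set ℝ} (hD : Convex ℝ D)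
    (hg : ∀ t ∈ D, HasDerivAt g (g' t) t) (hg' : ∀ t ∈ D, 0 ≤ g' t) : MonotoneOn g D :=
  monotoneOn_of_hasDerivWithinAt_nonneg hD (HasDerivAt.continuousOn hg)
    (fun t ht => (hg t (interior_subset ht)).hasDerivWithinAt)
    fun t ht => hg' t (interior_subset ht)

lemma lt_of_hasDerivAt_pos {g g' : ℝ → ℝ} {a b : ℝ} (hab : a < b)
    (hg : ∀ t ∈ Icc a b, HasDerivAt g (g' t) t) (hg' : ∀ t ∈ Ioo a b, 0 < g' t) : g a < g b :=
  strictMonoOn_of_hasDerivWithinAt_pos (convex_Icc a b) (HasDerivAt.continuousOn hg)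
    (fun t ht => (hg t (interior_subset ht)).hasDerivWithinAt)
    (fun t ht => hg' t (interior_Icc (a := a) ▸ ht))
    (left_mem_Icc.2 hab.le) (right_mem_Icc.2 hab.le) hab

lemma eventually_pos_nhdsGT {w : ℝ → ℝ} {a : ℝ} (hw : 0 < deriv w a) (h₀ : w a = 0) :
    ∀ᶠ t in 𝓝[>] a, 0 < w t := by
  filter_upwards [eventually_nhdsWithin_of_eventually_nhds
    (eventually_nhdsWithin_sign_eq_of_deriv_pos hw h₀), self_mem_nhdsWithin] with t ht hat
  exact sign_eq_one_iff.1 (ht.trans (sign_pos (sub_pos.2 hat)))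

lemma deriv_nonpos_of_eventually_pos_nhdsLT {w : ℝ → ℝ} {a : ℝ} (hw : ∀ᶠ t in 𝓝[<] a, 0 < w t)
    (h₀ : w a = 0) : deriv w a ≤ 0 := by
  by_contra! hpos
  obtain ⟨t, hwt, ht, hta⟩ := (hw.and ((eventually_nhdsWithin_of_eventually_nhds
    (eventually_nhdsWithin_sign_eq_of_deriv_pos hpos h₀)).and self_mem_nhdsWithin)).exists
  exact hwt.not_gt (sign_eq_neg_one_iff.1 (ht.trans (sign_neg (sub_neg.2 hta))))

lemma exists_first_zero {w : ℝ → ℝ} {a b : ℝ} (hab : a < b) (hw : ContinuousOn w (Icc a b))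
    (ha : ∀ᶠ t in 𝓝[>] a, 0 < w t) (hb : w b ≤ 0) :
    ∃ τ ∈ Ioc a b, w τ = 0 ∧ ∀ t ∈ Ioo a τ, 0 < w t := by
  obtain ⟨c, hac, hpos⟩ := mem_nhdsGT_iff_exists_Ioo_subset.1 ha
  obtain ⟨s, has, hsc⟩ := exists_between (lt_min hac hab)
  have hs : 0 < w s := hpos ⟨has, hsc.trans_le (min_le_left _ _)⟩
  have hsub : Icc s b ⊆ Icc a b := Icc_subset_Icc_left has.le
  have hclosed : IsClosed (Icc s b ∩ w ⁻¹' Iic 0) :=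
    (hw.mono hsub).preimage_isClosed_of_isClosed isClosed_Icc isClosed_Iic
  obtain ⟨τ, ⟨⟨hsτ, hτb⟩, hwτ⟩, hτ⟩ :=
    (isCompact_Icc.of_isClosed_subset hclosed inter_subset_left).exists_isLeast
      ⟨b, ⟨(hsc.trans_le (min_le_right _ _)).le, le_rfl⟩, hb⟩
  obtain ⟨τ', ⟨hsτ', hτ'τ⟩, hwτ'⟩ : 0 ∈ w '' Icc s τ :=
    intermediate_value_Icc' hsτ ((hw.mono hsub).mono (Icc_subset_Icc_right hτb)) ⟨hwτ, hs.le⟩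
  obtain rfl : τ' = τ := hτ'τ.antisymm (hτ ⟨⟨hsτ', hτ'τ.trans hτb⟩, hwτ'.le⟩)
  refine ⟨τ', ⟨has.trans_le hsτ, hτb⟩, hwτ', fun t ht => ?_⟩
  rcases le_total s t with hst | hts
  · by_contra! hwt
    exact ht.2.not_ge (hτ ⟨⟨hst, ht.2.le.trans hτb⟩, hwt⟩)
  · exact hpos ⟨ht.1, hts.trans_lt (hsc.trans_le (min_le_left _ _))⟩

end Calculus

section BlowUp

variable {z z' f : ℝ → ℝ} {a b : ℝ}

lemma cube_lt_sq_deriv (hab : a ≤ b)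
    (hz : ∀ t ∈ Icc a b, HasDerivAt z (z' t) t) (hz' : ∀ t ∈ Icc a b, HasDerivAt z' (f t) t)
    (hf : ∀ t ∈ Icc a b, 6 * z t ^ 2 ≤ f t) (hpos : ∀ t ∈ Icc a b, 0 ≤ z' t)
    (hb : 0 < z b) (hzab : 2 * z a ≤ z b) : z b ^ 3 < z' b ^ 2 := by
  have hmono : MonotoneOn (fun t => z' t ^ 2 - 4 * z t ^ 3) (Icc a b) :=
    monotoneOn_of_hasDerivAt_nonneg (convex_Icc a b)
      (fun t ht => ((hz' t ht).fun_pow 2).fun_sub (((hz t ht).fun_pow 3).const_mul 4))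
      fun t ht => by
        have : 0 ≤ z' t * (f t - 6 * z t ^ 2) :=
          mul_nonneg (hpos t ht) (sub_nonneg.2 (hf t ht))
        norm_num
        linarith
  have henergy : z' a ^ 2 - 4 * z a ^ 3 ≤ z' b ^ 2 - 4 * z b ^ 3 :=
    hmono (left_mem_Icc.2 hab) (right_mem_Icc.2 hab) hab
  have hcube : (2 * z a) ^ 3 ≤ z b ^ 3 := (by decide : Odd 3).pow_le_pow.2 hzab
  nlinarith [pow_pos hb 3, sq_nonneg (z' a)]

lemma inv_sqrt_add_half_le (hab : a ≤ b)
    (hz : ∀ t ∈ Icc a b, HasDerivAt z (z' t) t) (hpos : ∀ t ∈ Icc a b, 0 < z t)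
    (hz' : ∀ t ∈ Icc a b, √(z t) ^ 3 ≤ z' t) :
    (√(z b))⁻¹ + (b - a) / 2 ≤ (√(z a))⁻¹ := by
  have hmono : MonotoneOn (fun t => -(√(z t))⁻¹ - t / 2) (Icc a b) :=
    monotoneOn_of_hasDerivAt_nonneg (convex_Icc a b)
      (fun t ht => (((hz t ht).sqrt (hpos t ht).ne').fun_inv
        (Real.sqrt_pos.2 (hpos t ht)).ne').fun_neg.fun_sub ((hasDerivAt_id' t).div_const 2))
      fun t ht => by
        have hw : 0 < √(z t) := Real.sqrt_pos.2 (hpos t ht)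
        have : -(-(z' t / (2 * √(z t))) / √(z t) ^ 2) = z' t / (2 * √(z t) ^ 3) := by field_simp
        rw [this, sub_nonneg, div_le_div_iff₀ two_pos (by positivity)]
        linarith [hz' t ht]
  have := hmono (left_mem_Icc.2 hab) (right_mem_Icc.2 hab) hab
  dsimp only at this
  linarith

lemma sub_lt_two_mul_inv_sqrt (hab : a ≤ b)
    (hz : ∀ t ∈ Icc a b, HasDerivAt z (z' t) t) (hz' : ∀ t ∈ Icc a b, HasDerivAt z' (f t) t)
    (hf : ∀ t ∈ Icc a b, 6 * z t ^ 2 ≤ f t)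
    (ha : 0 < z a) (ha' : 0 < z' a) (hE : z a ^ 3 ≤ z' a ^ 2) : b - a < 2 * (√(z a))⁻¹ := by
  have hamem : a ∈ Icc a b := left_mem_Icc.2 hab
  have hmono' : MonotoneOn z' (Icc a b) := monotoneOn_of_hasDerivAt_nonneg (convex_Icc a b) hz'
    fun t ht => (by positivity : 0 ≤ 6 * z t ^ 2).trans (hf t ht)
  have hpos' : ∀ t ∈ Icc a b, 0 < z' t := fun t ht => ha'.trans_le (hmono' hamem ht ht.1)
  have hmono : MonotoneOn z (Icc a b) :=
    monotoneOn_of_hasDerivAt_nonneg (convex_Icc a b) hz fun t ht => (hpos' t ht).le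
  have hpos : ∀ t ∈ Icc a b, 0 < z t := fun t ht => ha.trans_le (hmono hamem ht ht.1)
  have hEmono : MonotoneOn (fun t => z' t ^ 2 - z t ^ 3) (Icc a b) :=
    monotoneOn_of_hasDerivAt_nonneg (convex_Icc a b)
      (fun t ht => ((hz' t ht).fun_pow 2).fun_sub ((hz t ht).fun_pow 3))
      fun t ht => by
        have : 0 ≤ z' t * (2 * f t - 3 * z t ^ 2) :=
          mul_nonneg (hpos' t ht).le (by linarith [hf t ht, sq_nonneg (z t)])
        norm_num
        linarith
  have hz'ge : ∀ t ∈ Icc a b, √(z t) ^ 3 ≤ z' t := fun t ht => by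
    have hEt : z' a ^ 2 - z a ^ 3 ≤ z' t ^ 2 - z t ^ 3 := hEmono hamem ht ht.1
    refine le_of_sq_le_sq ?_ (hpos' t ht).le
    calc (√(z t) ^ 3) ^ 2 = (√(z t) ^ 2) ^ 3 := by ring
      _ = z t ^ 3 := by rw [Real.sq_sqrt (hpos t ht).le]
      _ ≤ z' t ^ 2 := by linarith
  have hend : 0 < (√(z b))⁻¹ := inv_pos.2 (Real.sqrt_pos.2 (hpos b (right_mem_Icc.2 hab)))
  linarith [inv_sqrt_add_half_le hab hz hpos hz'ge]

lemma add_mul_sq_le_of_le_deriv {M : ℝ} (hab : a ≤ b)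
    (hz : ∀ t ∈ Icc a b, HasDerivAt z (z' t) t) (hz' : ∀ t ∈ Icc a b, M * (t - a) ≤ z' t) :
    z a + M * (b - a) ^ 2 / 2 ≤ z b := by
  have hmono : MonotoneOn (fun t => z t - M * (t - a) ^ 2 / 2) (Icc a b) :=
    monotoneOn_of_hasDerivAt_nonneg (convex_Icc a b)
      (fun t ht => (hz t ht).fun_sub
        (((((hasDerivAt_id' t).sub_const a).fun_pow 2).const_mul M).div_const 2))
      fun t ht => by
        norm_num
        linarith [hz' t ht]
  have := hmono (left_mem_Icc.2 hab) (right_mem_Icc.2 hab) hab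
  simp only [sub_self] at this
  linarith

lemma mul_sub_le_of_le_deriv {M t : ℝ} (ht : t ∈ Icc a b)
    (hz : ∀ s ∈ Icc a b, HasDerivAt z (z' s) s) (hM : ∀ s ∈ Icc a b, M ≤ z' s) (ha : 0 ≤ z a) :
    M * (t - a) ≤ z t := by
  have hmono : MonotoneOn (fun s => z s - M * (s - a)) (Icc a b) :=
    monotoneOn_of_hasDerivAt_nonneg (convex_Icc a b)
      (fun s hs => (hz s hs).fun_sub (((hasDerivAt_id' s).sub_const a).const_mul M))
      fun s hs => by linarith [hM s hs]
  have := hmono (left_mem_Icc.2 (ht.1.trans ht.2)) ht ht.1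
  simp only [sub_self, mul_zero] at this
  linarith

lemma sub_lt_add_one_of_le_deriv_deriv {T M : ℝ} (hT : 0 < T) (hM : 0 < M)
    (hz : ∀ t ∈ Icc a b, HasDerivAt z (z' t) t) (hz' : ∀ t ∈ Icc a b, HasDerivAt z' (f t) t)
    (hf : ∀ t ∈ Icc a b, 6 * z t ^ 2 ≤ f t) (hfM : ∀ t ∈ Icc a b, M ≤ f t)
    (ha : 0 ≤ z' a) (hTM : |z a| + 4 ≤ M * T ^ 2 / 2) : b - a < T + 1 := by
  by_contra! hab
  have hz'ge : ∀ t ∈ Icc a b, M * (t - a) ≤ z' t := fun t ht =>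
    mul_sub_le_of_le_deriv ht hz' hfM ha
  have hle : a ≤ a + T := by linarith
  have hleft : Icc a (a + T) ⊆ Icc a b := Icc_subset_Icc_right (by linarith)
  have hright : Icc (a + T) b ⊆ Icc a b := Icc_subset_Icc_left hle
  have hmem : a + T ∈ Icc a b := hleft (right_mem_Icc.2 hle)
  have hgrowth : z a + M * T ^ 2 / 2 ≤ z (a + T) := by
    simpa only [add_sub_cancel_left] using add_mul_sq_le_of_le_deriv hle
      (fun t ht => hz t (hleft ht)) fun t ht => hz'ge t (hleft ht)
  have hfour : 4 ≤ z (a + T) := by linarith [neg_abs_le (z a)]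
  have hcube : z (a + T) ^ 3 < z' (a + T) ^ 2 := by
    refine cube_lt_sq_deriv hle (fun t ht => hz t (hleft ht)) (fun t ht => hz' t (hleft ht))
      (fun t ht => hf t (hleft ht)) (fun t ht => ?_) (by linarith)
      (by linarith [le_abs_self (z a)])
    exact (mul_nonneg hM.le (sub_nonneg.2 ht.1)).trans (hz'ge t (hleft ht))
  have hz'pos : 0 < z' (a + T) := by
    refine lt_of_lt_of_le ?_ (hz'ge _ hmem)
    simpa only [add_sub_cancel_left] using mul_pos hM hT
  have hlife : b - (a + T) < 2 * (√(z (a + T)))⁻¹ :=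
    sub_lt_two_mul_inv_sqrt hmem.2 (fun t ht => hz t (hright ht)) (fun t ht => hz' t (hright ht))
      (fun t ht => hf t (hright ht)) (by linarith) hz'pos hcube.le
  have hsqrt : (√(z (a + T)))⁻¹ ≤ 2⁻¹ :=
    inv_anti₀ two_pos (Real.le_sqrt_of_sq_le (by linarith))
  linarith

end BlowUp

section Convexity

namespace IsP1Solution

variable {I : Set ℝ} {y : ℝ → ℝ} {a b c x τ : ℝ}

lemma notMem_of_isLUB (h : IsP1Solution I y) (hb : IsLUB I b) : b ∉ I := fun hbI =>
  have ⟨_, hbx, hx⟩ := Filter.Eventually.exists_gt (h.isOpen.mem_nhds hbI)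
  (hb.1 hx).not_gt hbx

lemma notMem_of_isGLB (h : IsP1Solution I y) (ha : IsGLB I a) : a ∉ I := fun haI =>
  have ⟨_, hax, hx⟩ := Filter.Eventually.exists_lt (h.isOpen.mem_nhds haI)
  (ha.1 hx).not_gt hax

lemma lt_of_isLUB (h : IsP1Solution I y) (hb : IsLUB I b) (hc : c ∈ I) : c < b :=
  (hb.1 hc).lt_of_ne (ne_of_mem_of_not_mem hc (h.notMem_of_isLUB hb))

lemma Ico_subset_of_isLUB (h : IsP1Solution I y) (hb : IsLUB I b) (hc : c ∈ I) : Ico c b ⊆ I :=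
  fun _ hx => have ⟨_, hd, hxd⟩ := (lt_isLUB_iff hb).1 hx.2
  h.ordConnected.out hc hd ⟨hx.1, hxd.le⟩

lemma exists_lt_abs (h : IsP1Solution I y) (hτ : τ ∉ I) {s : Set ℝ} (hs : s ⊆ I)
    (hconv : Convex ℝ s) (hbdd : Bornology.IsBounded s) (hcl : τ ∈ closure s) (R : ℝ) :
    ∃ t ∈ s, R < |y t| := by
  by_contra! hR
  obtain ⟨c, hc⟩ := closure_nonempty_iff.1 ⟨τ, hcl⟩
  obtain ⟨B, hB⟩ := isBounded_iff_forall_norm_le.1 hbdd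
  have hsecond : ∀ t ∈ s, ‖6 * y t ^ 2 - t‖ ≤ 6 * R ^ 2 + B := fun t ht =>
    (norm_sub_le _ _).trans (add_le_add (by
      rw [Real.norm_of_nonneg (by positivity), ← sq_abs]
      gcongr
      exact hR t ht) (hB t ht))
  have hderiv : ∀ t ∈ s, ‖deriv y t‖ ≤ ‖deriv y c‖ + (6 * R ^ 2 + B) * (B + B) := fun t ht => by
    have hmv : ‖deriv y t - deriv y c‖ ≤ (6 * R ^ 2 + B) * ‖t - c‖ :=
      hconv.norm_image_sub_le_of_norm_hasDerivWithin_le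
        (fun x hx => (h.solves x (hs hx)).2.hasDerivWithinAt) hsecond hc ht
    have htc : ‖t - c‖ ≤ B + B := (norm_sub_le _ _).trans (add_le_add (hB t ht) (hB c hc))
    have hB' : 0 ≤ 6 * R ^ 2 + B := (norm_nonneg _).trans (hsecond c hc)
    calc ‖deriv y t‖ ≤ ‖deriv y c‖ + ‖deriv y t - deriv y c‖ := norm_le_norm_add_norm_sub' _ _
      _ ≤ _ := by gcongr; exact hmv.trans (by gcongr)
  have : (𝓝[s] τ).NeBot := mem_closure_iff_nhdsWithin_neBot.1 hcl
  have hphase : ∀ᶠ t in 𝓝[s] τ, ‖phase y t‖ ≤ max R (‖deriv y c‖ + (6 * R ^ 2 + B) * (B + B)) :=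
    eventually_mem_nhdsWithin.mono fun t ht => max_le_max (hR t ht) (hderiv t ht)
  exact h.not_frequently_bounded hτ _ (hphase.frequently.filter_mono (nhdsWithin_mono τ hs))

lemma convex_inter_Iic (h : IsP1Solution I y) : Convex ℝ (I ∩ Iic 0) :=
  (h.ordConnected.inter ordConnected_Iic).convex

lemma strictMonoOn_deriv (h : IsP1Solution I y) : StrictMonoOn (deriv y) (I ∩ Iic 0) := by
  refine strictMonoOn_of_deriv_pos h.convex_inter_Iic
    (h.solves.continuousOn_deriv.mono inter_subset_left) fun x hx => ?_
  rw [interior_inter, interior_Iic] at hx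
  rw [(h.solves x (interior_subset hx.1)).2.deriv, sub_pos]
  exact lt_of_lt_of_le hx.2 (by positivity)

lemma tangent_lt (h : IsP1Solution I y) (hc : c ∈ I ∩ Iic 0) (hx : x ∈ I ∩ Iic 0) (hxc : x ≠ c) :
    y c + deriv y c * (x - c) < y x := by
  have hconv : StrictConvexOn ℝ (I ∩ Iic 0) y :=
    (h.strictMonoOn_deriv.mono interior_subset).strictConvexOn_of_deriv h.convex_inter_Iic
      (h.solves.continuousOn.mono inter_subset_left)
  rcases hxc.lt_or_gt with hlt | hlt
  · have hslope := hconv.slope_lt_of_hasDerivAt hx hc hlt (h.solves.hasDerivAt hc.1)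
    rw [slope_def_field, div_lt_iff₀ (sub_pos.2 hlt)] at hslope
    linarith
  · have hslope := hconv.lt_slope_of_hasDerivAt hc hx hlt (h.solves.hasDerivAt hc.1)
    rw [slope_def_field, lt_div_iff₀ (sub_pos.2 hlt)] at hslope
    linarith

lemma exists_lt (h : IsP1Solution I y) (hτ : τ ∉ I) {s : Set ℝ} (hs : s ⊆ I ∩ Iic 0)
    (hconv : Convex ℝ s) (hbdd : Bornology.IsBounded s) (hcl : τ ∈ closure s) (R : ℝ) :
    ∃ t ∈ s, R < y t := by
  obtain ⟨c, hc⟩ := closure_nonempty_iff.1 ⟨τ, hcl⟩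
  obtain ⟨B, hB⟩ := isBounded_iff_forall_norm_le.1 hbdd
  have hbelow : ∀ t ∈ s, -(|y c| + |deriv y c| * (B + |c|)) ≤ y t := fun t ht => by
    have htangent : y c + deriv y c * (t - c) ≤ y t := by
      rcases eq_or_ne t c with rfl | hne
      · simp
      · exact (h.tangent_lt (hs hc) (hs ht) hne).le
    have hlinear : |deriv y c * (t - c)| ≤ |deriv y c| * (B + |c|) := by
      rw [abs_mul]
      gcongr
      exact (abs_sub _ _).trans (by gcongr; exact hB t ht)
    linarith [neg_abs_le (y c), neg_abs_le (deriv y c * (t - c))]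
  obtain ⟨t, ht, hlt⟩ := h.exists_lt_abs hτ (hs.trans inter_subset_left) hconv hbdd hcl
    (max R (|y c| + |deriv y c| * (B + |c|)))
  obtain ⟨hR, hne⟩ := max_lt_iff.1 hlt
  rcases lt_abs.1 hne with hpos | hneg
  · rw [abs_of_pos (by
      have hB0 : 0 ≤ B := (norm_nonneg _).trans (hB c hc)
      exact lt_of_le_of_lt (by positivity) hpos)] at hR
    exact ⟨t, ht, hR⟩
  · linarith [hbelow t ht]

lemma exists_Ico_lt (h : IsP1Solution I y) (hb : IsLUB I b) (hb₀ : b ≤ 0) (hc : c ∈ I) (R : ℝ) :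
    ∃ t ∈ Ico c b, R < y t := by
  refine h.exists_lt (h.notMem_of_isLUB hb)
    (fun t ht => ⟨h.Ico_subset_of_isLUB hb hc ht, ht.2.le.trans hb₀⟩) (convex_Ico c b)
    (Metric.isBounded_Ico c b) ?_ R
  rw [closure_Ico (h.lt_of_isLUB hb hc).ne]
  exact right_mem_Icc.2 (hb.1 hc)

lemma exists_le_lt (h : IsP1Solution I y) (ha : IsGLB I a) (hc : c ∈ I ∩ Iic 0) (R : ℝ) :
    ∃ t ∈ I ∩ Iic c, R < y t :=
  h.exists_lt (h.notMem_of_isGLB ha) (fun _ ht => ⟨ht.1, le_trans (mem_Iic.1 ht.2) hc.2⟩)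
    (h.ordConnected.inter ordConnected_Iic).convex
    ((Metric.isBounded_Icc a c).subset fun _ ht => ⟨ha.1 ht.1, ht.2⟩)
    ((ha.inter_Iic_of_mem hc.1).mem_closure ⟨c, hc.1, self_mem_Iic⟩) R

lemma mul_deriv_pos_of_lt (h : IsP1Solution I y) (hc : c ∈ I ∩ Iic 0) (hx : x ∈ I ∩ Iic 0)
    (hcx : y c < y x) : 0 < (x - c) * deriv y x := by
  have hne : c ≠ x := ne_of_apply_ne y hcx.ne
  linarith [h.tangent_lt hx hc hne]

lemma lt_of_deriv_nonneg (h : IsP1Solution I y) (hc : c ∈ I ∩ Iic 0) (hx : x ∈ I ∩ Iic 0)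
    (hcx : c < x) (hd : 0 ≤ deriv y c) : y c < y x :=
  lt_of_le_of_lt (le_add_of_nonneg_right (mul_nonneg hd (sub_nonneg.2 hcx.le)))
    (h.tangent_lt hc hx hcx.ne')

lemma lt_of_deriv_eq_zero (h : IsP1Solution I y) (hc : c ∈ I ∩ Iic 0) (hd : deriv y c = 0)
    (hx : x ∈ I ∩ Iic 0) (hxc : x ≠ c) : y c < y x := by
  simpa [hd] using h.tangent_lt hc hx hxc

lemma tendsto_atTop (h : IsP1Solution I y) (hb : IsLUB I b) (hb₀ : b ≤ 0) :
    Tendsto y (𝓝[<] b) atTop := by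
  have mem : ∀ {t}, t ∈ I → t ∈ I ∩ Iic 0 := fun ht => ⟨ht, (hb.1 ht).trans hb₀⟩
  obtain ⟨c, hc⟩ := h.isConnected.nonempty
  refine Filter.tendsto_atTop.2 fun R => ?_
  obtain ⟨t, ⟨hct, htb⟩, hlt⟩ := h.exists_Ico_lt hb hb₀ hc (max R (y c))
  obtain ⟨hRt, hyct⟩ := max_lt_iff.1 hlt
  have ht : t ∈ I := h.Ico_subset_of_isLUB hb hc ⟨hct, htb⟩
  have hd : 0 < deriv y t :=
    pos_of_mul_pos_right (h.mul_deriv_pos_of_lt (mem hc) (mem ht) hyct) (sub_nonneg.2 hct)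
  filter_upwards [Ioo_mem_nhdsLT htb] with x hx
  exact (hRt.trans (h.lt_of_deriv_nonneg (mem ht)
    (mem (h.Ico_subset_of_isLUB hb ht ⟨hx.1.le, hx.2⟩)) hx.1 hd.le)).le

lemma exists_deriv_nonpos (h : IsP1Solution I y) (hc : c ≤ -1) (hI : Iic c ⊆ I) :
    ∃ x ≤ c, deriv y x ≤ 0 := by
  refine ⟨c - |deriv y c|, sub_le_self _ (abs_nonneg _), ?_⟩
  have hmono : MonotoneOn (fun t => deriv y t - t) (Iic c) :=
    monotoneOn_of_hasDerivAt_nonneg (convex_Iic c)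
      (fun t ht => (h.solves t (hI ht)).2.fun_sub (hasDerivAt_id' t))
      fun t ht => by linarith [sq_nonneg (y t), show t ≤ c from ht]
  have := hmono (sub_le_self c (abs_nonneg (deriv y c))) self_mem_Iic
    (sub_le_self c (abs_nonneg (deriv y c)))
  dsimp only at this
  linarith [le_abs_self (deriv y c)]

lemma bddBelow (h : IsP1Solution I y) : BddBelow I := by
  by_contra hI
  obtain ⟨c, hc, hc₁⟩ := not_bddBelow_iff.1 hI (-1)
  have hsub : Iic c ⊆ I := fun t ht =>
    have ⟨_, hd, hdt⟩ := not_bddBelow_iff.1 hI t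
    h.ordConnected.out hd hc ⟨hdt.le, ht⟩
  obtain ⟨x, hxc, hx⟩ := h.exists_deriv_nonpos hc₁.le hsub
  have hmem : ∀ t, -x ≤ t → -t ∈ I := fun t ht => hsub ((neg_le.1 ht).trans hxc)
  set T := √(2 * (|y x| + 4)) with hT
  have hT₀ : 0 < T := Real.sqrt_pos.2 (by positivity)
  have hlife : -x + T + 1 - -x < T + 1 :=
    sub_lt_add_one_of_le_deriv_deriv (M := 1) (z := fun t => y (-t))
      (z' := fun t => -deriv y (-t)) (f := fun t => 6 * y (-t) ^ 2 - -t) hT₀ one_pos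
      (fun t ht => by
        simpa using! (h.solves.hasDerivAt (hmem t ht.1)).comp t (hasDerivAt_neg t))
      (fun t ht => by
        simpa using! ((h.solves _ (hmem t ht.1)).2.comp t (hasDerivAt_neg t)).fun_neg)
      (fun t ht => by linarith [ht.1]) (fun t ht => by linarith [ht.1, sq_nonneg (y (-t))])
      (by simpa using hx) (by rw [hT, Real.sq_sqrt (by positivity), neg_neg]; linarith)
  linarith

lemma exists_deriv_eq_zero (h : IsP1Solution I y) (hI : I ⊆ Iic 0) : ∃ m ∈ I, deriv y m = 0 := by
  obtain ⟨c, hc⟩ := h.isConnected.nonempty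
  have hb : IsLUB I (sSup I) := isLUB_csSup ⟨c, hc⟩ ⟨0, hI⟩
  have ha : IsGLB I (sInf I) := isGLB_csInf ⟨c, hc⟩ h.bddBelow
  obtain ⟨s, ⟨hs, hsc⟩, hys⟩ := h.exists_le_lt ha ⟨hc, hI hc⟩ (y c)
  obtain ⟨t, ht, hyt⟩ := h.exists_Ico_lt hb (csSup_le ⟨c, hc⟩ hI) hc (y c)
  have htI : t ∈ I := h.Ico_subset_of_isLUB hb hc ht
  have hds : deriv y s < 0 :=
    neg_of_mul_pos_right (h.mul_deriv_pos_of_lt ⟨hc, hI hc⟩ ⟨hs, hI hs⟩ hys) (sub_nonpos.2 hsc)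
  have hdt : 0 < deriv y t := pos_of_mul_pos_right
    (h.mul_deriv_pos_of_lt ⟨hc, hI hc⟩ ⟨htI, hI htI⟩ hyt) (sub_nonneg.2 ht.1)
  exact h.isConnected.isPreconnected.intermediate_value hs htI h.solves.continuousOn_deriv
    ⟨hds.le, hdt.le⟩

end IsP1Solution

end Convexity

section Comparison

variable {I I₁ I₂ : Set ℝ} {y y₁ y₂ : ℝ → ℝ} {m₁ m₂ yl b x τ T : ℝ}

/-- The energy `y'²/2 - 2y³ + xy` of a solution of the first Painlevé equation; its derivative
along the solution is `y`. -/
noncomputable def p1Energy (y : ℝ → ℝ) (x : ℝ) : ℝ := deriv y x ^ 2 / 2 - 2 * y x ^ 3 + x * y x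

lemma SolvesP1On.hasDerivAt_p1Energy (h : SolvesP1On I y) (hx : x ∈ I) :
    HasDerivAt (p1Energy y) (y x) x := by
  have hy := h.hasDerivAt hx
  have hE : HasDerivAt (p1Energy y) _ x :=
    ((((h x hx).2.fun_pow 2).div_const 2).fun_sub ((hy.fun_pow 3).const_mul 2)).fun_add
      ((hasDerivAt_id' x).fun_mul hy)
  convert! hE using 1
  push_cast
  ring

lemma IsP1Solution.eventually_lt_add (h₁ : IsP1Solution I₁ y₁) (h₂ : IsP1Solution I₂ y₂)
    (hm : m₁ < m₂) (hm₁ : m₁ ∈ I₁) (hm₂ : m₂ ∈ I₂) (hphase : phase y₁ m₁ = phase y₂ m₂) :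
    ∀ᶠ t in 𝓝[>] 0, y₂ (m₂ + t) < y₁ (m₁ + t) := by
  obtain ⟨hval, hder⟩ := Prod.ext_iff.1 hphase
  simp only [phase] at hval hder
  have hD : ∀ t, m₁ + t ∈ I₁ → m₂ + t ∈ I₂ → HasDerivAt (fun t => y₁ (m₁ + t) - y₂ (m₂ + t))
      (deriv y₁ (m₁ + t) - deriv y₂ (m₂ + t)) t := fun t ht₁ ht₂ =>
    ((h₁.solves.hasDerivAt ht₁).comp_const_add m₁ t).fun_sub
      ((h₂.solves.hasDerivAt ht₂).comp_const_add m₂ t)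
  have hD₀ : HasDerivAt (fun t => deriv y₁ (m₁ + t) - deriv y₂ (m₂ + t)) (m₂ - m₁) 0 := by
    have hsecond : HasDerivAt (fun t => deriv y₁ (m₁ + t) - deriv y₂ (m₂ + t))
        (6 * y₁ (m₁ + 0) ^ 2 - (m₁ + 0) - (6 * y₂ (m₂ + 0) ^ 2 - (m₂ + 0))) 0 :=
      ((h₁.solves _ (by simpa using hm₁)).2.comp_const_add m₁ 0).fun_sub
        ((h₂.solves _ (by simpa using hm₂)).2.comp_const_add m₂ 0)
    convert! hsecond using 1
    rw [add_zero, add_zero, hval]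
    ring
  have hslope : ∀ᶠ t in 𝓝[>] 0, 0 < deriv y₁ (m₁ + t) - deriv y₂ (m₂ + t) :=
    eventually_pos_nhdsGT (by rw [hD₀.deriv]; exact sub_pos.2 hm) (by simp [hder])
  have hdom : ∀ᶠ t in 𝓝 (0 : ℝ), m₁ + t ∈ I₁ ∧ m₂ + t ∈ I₂ :=
    ((continuous_const_add m₁).continuousAt.eventually_mem
      (h₁.isOpen.mem_nhds (by simpa using hm₁))).and
    ((continuous_const_add m₂).continuousAt.eventually_mem
      (h₂.isOpen.mem_nhds (by simpa using hm₂)))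
  obtain ⟨ε, hε, hsub⟩ := mem_nhdsGT_iff_exists_Ioo_subset.1
    (hslope.and (eventually_nhdsWithin_of_eventually_nhds hdom))
  filter_upwards [Ioo_mem_nhdsGT hε] with t ht
  have hmono := lt_of_hasDerivAt_pos ht.1 (fun s hs => by
      rcases hs.1.eq_or_lt with rfl | hs₀
      · exact hD 0 (by simpa using hm₁) (by simpa using hm₂)
      · have hs' := (hsub ⟨hs₀, hs.2.trans_lt ht.2⟩).2
        exact hD s hs'.1 hs'.2)
    fun s hs => (hsub ⟨hs.1, hs.2.trans ht.2⟩).1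
  simpa [hval] using hmono

lemma IsP1Solution.deriv_lt_deriv_of_crossing (h₁ : IsP1Solution I₁ y₁) (h₂ : IsP1Solution I₂ y₂)
    (hm : m₁ < m₂) (hm₁ : m₁ ∈ I₁) (hm₂ : m₂ ∈ I₂) (hp₁ : phase y₁ m₁ = (yl, 0))
    (hp₂ : phase y₂ m₂ = (yl, 0)) (hτ : 0 < τ) (hτ₁ : m₁ + τ ∈ I₁) (hτ₂ : m₂ + τ ∈ I₂)
    (hτ₀ : m₂ + τ ≤ 0) (hlt : ∀ t ∈ Ioo 0 τ, y₂ (m₂ + t) < y₁ (m₁ + t))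
    (heq : y₁ (m₁ + τ) = y₂ (m₂ + τ)) : deriv y₂ (m₂ + τ) < deriv y₁ (m₁ + τ) := by
  obtain ⟨hy₁, hd₁⟩ := Prod.ext_iff.1 hp₁
  obtain ⟨hy₂, hd₂⟩ := Prod.ext_iff.1 hp₂
  simp only [phase] at hy₁ hd₁ hy₂ hd₂
  have hmem₁ : ∀ t ∈ Icc 0 τ, m₁ + t ∈ I₁ := fun t ht =>
    h₁.ordConnected.out hm₁ hτ₁ ⟨by linarith [ht.1], by linarith [ht.2]⟩
  have hmem₂ : ∀ t ∈ Icc 0 τ, m₂ + t ∈ I₂ := fun t ht =>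
    h₂.ordConnected.out hm₂ hτ₂ ⟨by linarith [ht.1], by linarith [ht.2]⟩
  have henergy := lt_of_hasDerivAt_pos hτ
    (fun t ht => ((h₁.solves.hasDerivAt_p1Energy (hmem₁ t ht)).comp_const_add m₁ t).fun_sub
      ((h₂.solves.hasDerivAt_p1Energy (hmem₂ t ht)).comp_const_add m₂ t))
    fun t ht => sub_pos.2 (hlt t ht)
  simp only [p1Energy, add_zero, hy₁, hd₁, hy₂, hd₂, heq] at henergy
  have hm₂' : m₂ ∈ I₂ ∩ Iic 0 := ⟨hm₂, by simp only [mem_Iic]; linarith⟩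
  have hrise : yl < y₂ (m₂ + τ) := hy₂ ▸
    h₂.lt_of_deriv_nonneg hm₂' ⟨hτ₂, hτ₀⟩ (lt_add_of_pos_right m₂ hτ) hd₂.ge
  have hpos : 0 < deriv y₁ (m₁ + τ) := hd₁ ▸
    h₁.strictMonoOn_deriv ⟨hm₁, by simp only [mem_Iic]; linarith⟩
      ⟨hτ₁, by simp only [mem_Iic]; linarith⟩ (lt_add_of_pos_right m₁ hτ)
  have hgain : 0 < (m₂ - m₁) * (y₂ (m₂ + τ) - yl) := mul_pos (sub_pos.2 hm) (sub_pos.2 hrise)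
  exact lt_of_pow_lt_pow_left₀ 2 hpos.le (by linarith)

lemma IsP1Solution.lt_add_of_critical_lt (h₁ : IsP1Solution I₁ y₁) (h₂ : IsP1Solution I₂ y₂)
    (hm : m₁ < m₂) (hm₁ : m₁ ∈ I₁) (hm₂ : m₂ ∈ I₂) (hp₁ : phase y₁ m₁ = (yl, 0))
    (hp₂ : phase y₂ m₂ = (yl, 0)) (hT : 0 < T) (hT₁ : m₁ + T ∈ I₁) (hT₂ : m₂ + T ∈ I₂)
    (hT₀ : m₂ + T ≤ 0) : y₂ (m₂ + T) < y₁ (m₁ + T) := by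
  have hmem₁ : ∀ t ∈ Icc 0 T, m₁ + t ∈ I₁ := fun t ht =>
    h₁.ordConnected.out hm₁ hT₁ ⟨by linarith [ht.1], by linarith [ht.2]⟩
  have hmem₂ : ∀ t ∈ Icc 0 T, m₂ + t ∈ I₂ := fun t ht =>
    h₂.ordConnected.out hm₂ hT₂ ⟨by linarith [ht.1], by linarith [ht.2]⟩
  have hD : ∀ t ∈ Icc 0 T, HasDerivAt (fun t => y₁ (m₁ + t) - y₂ (m₂ + t))
      (deriv y₁ (m₁ + t) - deriv y₂ (m₂ + t)) t := fun t ht =>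
    ((h₁.solves.hasDerivAt (hmem₁ t ht)).comp_const_add m₁ t).fun_sub
      ((h₂.solves.hasDerivAt (hmem₂ t ht)).comp_const_add m₂ t)
  by_contra! hle
  obtain ⟨τ, hτ, hτeq, hτlt⟩ := exists_first_zero hT (HasDerivAt.continuousOn hD)
    ((h₁.eventually_lt_add h₂ hm hm₁ hm₂ (hp₁.trans hp₂.symm)).mono fun t => sub_pos.2)
    (sub_nonpos.2 hle)
  have hτ' : τ ∈ Icc 0 T := Ioc_subset_Icc_self hτ
  have hfall : deriv y₁ (m₁ + τ) - deriv y₂ (m₂ + τ) ≤ 0 :=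
    (hD τ hτ').deriv.symm.trans_le (deriv_nonpos_of_eventually_pos_nhdsLT
      (by filter_upwards [Ioo_mem_nhdsLT hτ.1] using hτlt) hτeq)
  exact (sub_nonpos.1 hfall).not_gt (h₁.deriv_lt_deriv_of_crossing h₂ hm hm₁ hm₂ hp₁ hp₂ hτ.1
    (hmem₁ τ hτ') (hmem₂ τ hτ') (by linarith [hτ.2]) (fun t ht => sub_pos.1 (hτlt t ht))
    (sub_eq_zero.1 hτeq))

lemma IsP1Solution.notMem_of_critical_lt (h₁ : IsP1Solution I₁ y₁) (h₂ : IsP1Solution I₂ y₂)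
    (hm : m₁ < m₂) (hm₁ : m₁ ∈ I₁) (hm₂ : m₂ ∈ I₂) (hp₁ : phase y₁ m₁ = (yl, 0))
    (hp₂ : phase y₂ m₂ = (yl, 0)) (hb : IsLUB I₂ b) (hb₀ : b ≤ 0) (hx : m₁ + (b - m₂) ≤ x) :
    x ∉ I₁ := by
  intro hmem
  have hsub : Icc m₁ x ⊆ I₁ := h₁.ordConnected.out hm₁ hmem
  obtain ⟨R, hR⟩ := isCompact_Icc.bddAbove_image (h₁.solves.continuousOn.mono hsub)
  obtain ⟨t, ht, hlt⟩ := h₂.exists_Ico_lt hb hb₀ hm₂ (max R (y₂ m₂))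
  obtain ⟨hRt, hyt⟩ := max_lt_iff.1 hlt
  have hmt : m₂ < t := ht.1.lt_of_ne (ne_of_apply_ne y₂ hyt.ne)
  have hshift : m₁ + (t - m₂) ∈ Icc m₁ x := ⟨by linarith, by linarith [ht.2]⟩
  have hcompare := h₁.lt_add_of_critical_lt h₂ hm hm₁ hm₂ hp₁ hp₂ (sub_pos.2 hmt) (hsub hshift)
    (by simpa using h₂.Ico_subset_of_isLUB hb hm₂ ht) (by simpa using ht.2.le.trans hb₀)
  rw [add_sub_cancel] at hcompare
  exact (hcompare.trans_le (hR (mem_image_of_mem y₁ hshift))).not_gt hRt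

end Comparison

section Minimum

namespace IsP1Solution

variable {I J : Set ℝ} {y z : ℝ → ℝ} {b c m m' yl τ : ℝ}

lemma exists_isLUB_of_notMem (h : IsP1Solution I y) (hc : c ∈ I) (hτ : τ ∉ I) (hcτ : c < τ) :
    ∃ b ≤ τ, IsLUB I b := by
  have hup : τ ∈ upperBounds I := fun x hx => by
    by_contra! hτx
    exact hτ (h.ordConnected.out hc hx ⟨hcτ.le, hτx.le⟩)
  exact ⟨sSup I, csSup_le ⟨c, hc⟩ hup, isLUB_csSup ⟨c, hc⟩ ⟨τ, hup⟩⟩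

lemma lt_of_phase_eq (h : IsP1Solution I y) (hm : m ∈ I ∩ Iic 0) (hp : phase y m = (yl, 0))
    {x : ℝ} (hx : x ∈ I ∩ Iic 0) (hxm : x ≠ m) : yl < y x :=
  (congrArg Prod.fst hp).symm.trans_lt (h.lt_of_deriv_eq_zero hm (congrArg Prod.snd hp) hx hxm)

lemma le_of_phase_eq (h : IsP1Solution I y) (hm : m ∈ I ∩ Iic 0) (hp : phase y m = (yl, 0))
    {x : ℝ} (hx : x ∈ I ∩ Iic 0) : yl ≤ y x := by
  rcases eq_or_ne x m with rfl | hne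
  · exact (congrArg Prod.fst hp).ge
  · exact (h.lt_of_phase_eq hm hp hx hne).le

lemma phase_of_isMinOn (h : IsP1Solution I y) (hm : m ∈ I) (hmτ : m < τ)
    (hmin : ∀ x ∈ I, x ≤ τ → y m ≤ y x) : phase y m = (y m, 0) := by
  refine Prod.ext rfl (IsLocalMin.deriv_eq_zero ?_)
  filter_upwards [h.isOpen.mem_nhds hm, Iic_mem_nhds hmτ] with x hx hxτ using hmin x hx hxτ

lemma isLeast_image (h : IsP1Solution I y) (hI : I ⊆ Iic 0) (hm : m ∈ I)
    (hp : phase y m = (yl, 0)) : IsLeast (y '' I) yl :=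
  ⟨⟨m, hm, congrArg Prod.fst hp⟩,
    forall_mem_image.2 fun _ hx => h.le_of_phase_eq ⟨hm, hI hm⟩ hp ⟨hx, hI hx⟩⟩

lemma exists_phase_eq_of_isLeast (h : IsP1Solution I y) (hl : IsLeast (y '' I) yl) :
    ∃ m ∈ I, phase y m = (yl, 0) := by
  obtain ⟨⟨m, hm, rfl⟩, hmin⟩ := hl
  exact ⟨m, hm, h.phase_of_isMinOn hm (lt_add_one m) fun x hx _ => hmin (mem_image_of_mem y hx)⟩

lemma setOf_eq_singleton (h : IsP1Solution I y) (hI : I ⊆ Iic 0) (hm : m ∈ I)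
    (hp : phase y m = (yl, 0)) : {x | x ∈ I ∧ y x = yl} = {m} := by
  refine Subset.antisymm (fun x ⟨hx, hyx⟩ => ?_)
    (singleton_subset_iff.2 ⟨hm, congrArg Prod.fst hp⟩)
  by_contra hne
  exact (h.lt_of_phase_eq ⟨hm, hI hm⟩ hp ⟨hx, hI hx⟩ hne).ne' hyx

lemma not_lt_of_isLUB (h : IsP1Solution I y) (h' : IsP1Solution J z) (hb : IsLUB I b)
    (hb' : IsLUB J b) (hb₀ : b ≤ 0) (hm : m ∈ I) (hm' : m' ∈ J) (hp : phase y m = (yl, 0))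
    (hp' : phase z m' = (yl, 0)) : ¬ m < m' := fun hlt =>
  have hm'b : m' < b := h'.lt_of_isLUB hb' hm'
  h.notMem_of_critical_lt h' hlt hm hm' hp hp' hb' hb₀ le_rfl
    (h.Ico_subset_of_isLUB hb hm ⟨by linarith, by linarith⟩)

lemma eq_of_isLUB (h : IsP1Solution I y) (h' : IsP1Solution J z) (hb : IsLUB I b)
    (hb' : IsLUB J b) (hb₀ : b ≤ 0) (hl : IsLeast (y '' I) yl) (hl' : IsLeast (z '' J) yl) :
    I = J ∧ EqOn y z I := by
  obtain ⟨m, hm, hp⟩ := h.exists_phase_eq_of_isLeast hl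
  obtain ⟨m', hm', hp'⟩ := h'.exists_phase_eq_of_isLeast hl'
  obtain rfl : m = m' := eq_of_le_of_not_lt
    (not_lt.1 (h'.not_lt_of_isLUB h hb' hb hb₀ hm' hm hp' hp))
    (h.not_lt_of_isLUB h' hb hb' hb₀ hm hm' hp hp')
  exact h.eq_of_phase_eq h' hm hm' (hp.trans hp'.symm)

lemma mem_of_lt_critical (h : IsP1Solution I y) (hb : IsLUB I b) (hb₀ : b ≤ 0) (hm : m ∈ I)
    (hp : phase y m = (yl, 0)) (h' : IsP1Solution J z) (hm' : m' ∈ J)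
    (hp' : phase z m' = (yl, 0)) (hmm' : m < m') (hm'b : m' < b) : b ∈ J := by
  by_contra hbJ
  obtain ⟨b', hb'b, hb'⟩ := h'.exists_isLUB_of_notMem hm' hbJ hm'b
  have hm'b' : m' < b' := h'.lt_of_isLUB hb' hm'
  exact h.notMem_of_critical_lt h' hmm' hm hm' hp hp' hb' (hb'b.trans hb₀) le_rfl
    (h.Ico_subset_of_isLUB hb hm ⟨by linarith, by linarith⟩)

lemma lt_of_mem_of_critical (h : IsP1Solution I y) (hb : IsLUB I b) (hb₀ : b ≤ 0) (hm : m ∈ I)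
    (hp : phase y m = (yl, 0)) (h' : IsP1Solution J z) (hm' : m' ∈ J)
    (hp' : phase z m' = (yl, 0)) (hbJ : b ∈ J) : m < m' := by
  by_contra! hle
  rcases hle.lt_or_eq with hlt | rfl
  · exact h'.notMem_of_critical_lt h hlt hm' hm hp' hp hb hb₀ (by linarith) hbJ
  · obtain ⟨rfl, -⟩ := h.eq_of_phase_eq h' hm hm' (hp.trans hp'.symm)
    exact h.notMem_of_isLUB hb hbJ

lemma xminValues_eq_Ioo (h : IsP1Solution I y) (hb : IsLUB I b) (hb₀ : b ≤ 0) (hm : m ∈ I)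
    (hp : phase y m = (yl, 0)) : xminValues b yl = Ioo m b := by
  ext m'
  constructor
  · rintro ⟨y₀, -, J, z, hz, hbJ, -, hmJ, hm'b, rfl, hmin⟩
    exact ⟨h.lt_of_mem_of_critical hb hb₀ hm hp hz hmJ (hz.phase_of_isMinOn hmJ hm'b hmin) hbJ,
      hm'b⟩
  · rintro ⟨hmm', hm'b⟩
    obtain ⟨J, z, hz, hmJ, hpz⟩ := exists_isP1Solution m' (yl, 0)
    have hbJ : b ∈ J := h.mem_of_lt_critical hb hb₀ hm hp hz hmJ hpz hmm' hm'b
    have hmJ₀ : m' ∈ J ∩ Iic 0 := ⟨hmJ, hm'b.le.trans hb₀⟩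
    exact ⟨z b, hz.lt_of_phase_eq hmJ₀ hpz ⟨hbJ, hb₀⟩ hm'b.ne', J, z, hz, hbJ, rfl, hmJ, hm'b,
      congrArg Prod.fst hpz, fun x hx hxb => hz.le_of_phase_eq hmJ₀ hpz ⟨hx, hxb.trans hb₀⟩⟩

lemma isGLB_calXmin (h : IsP1Solution I y) (hI : I ⊆ Iic 0) (hb : IsLUB I b)
    (hl : IsLeast (y '' I) yl) :
    IsGLB (xminValues b yl) (calXmin b yl) ∧ {x | x ∈ I ∧ y x = yl} = {calXmin b yl} := by
  obtain ⟨m, hm, hp⟩ := h.exists_phase_eq_of_isLeast hl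
  have hmb : m < b := h.lt_of_isLUB hb hm
  rw [calXmin, h.xminValues_eq_Ioo hb ((isLUB_le_iff hb).2 hI) hm hp, csInf_Ioo hmb]
  exact ⟨isGLB_Ioo hmb, h.setOf_eq_singleton hI hm hp⟩

end IsP1Solution

end Minimum

section Existence

variable {I : ℝ → Set ℝ} {y : ℝ → ℝ → ℝ} {J : Set ℝ} {z : ℝ → ℝ} {b c m p x₀ yl : ℝ}

lemma tendsto_phase_of_phase_eq {Y₀ : ℝ × ℝ} (h : ∀ m, IsP1Solution (I m) (y m))
    (hm : ∀ m, m ∈ I m) (hp : ∀ m, phase (y m) m = Y₀) (hx : x₀ ∈ I c) :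
    (∀ᶠ m in 𝓝 c, x₀ ∈ I m) ∧
      Tendsto (fun m => phase (y m) x₀) (𝓝 c) (𝓝 (phase (y c) x₀)) :=
  have hinit : Tendsto (fun m => phase (y m) m) (𝓝 c) (𝓝 (phase (y c) c)) := by
    simpa only [hp] using tendsto_const_nhds (x := Y₀)
  (h c).tendsto_phase h (hm c) hx tendsto_id (Eventually.of_forall hm) hinit

lemma IsP1Solution.notMem_of_cube_le (h : IsP1Solution J z) (hp : p ∈ J) (hz : 0 < z p)
    (hd : 0 < deriv z p) (hcube : z p ^ 3 ≤ deriv z p ^ 2) (hx₀ : x₀ ≤ 0) (hpx : p ≤ x₀)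
    (hlong : 2 * (√(z p))⁻¹ ≤ x₀ - p) : x₀ ∉ J := fun hx =>
  have hsub : Icc p x₀ ⊆ J := h.ordConnected.out hp hx
  (sub_lt_two_mul_inv_sqrt (z' := deriv z) (f := fun t => 6 * z t ^ 2 - t) hpx
    (fun t ht => h.solves.hasDerivAt (hsub ht)) (fun t ht => (h.solves t (hsub ht)).2)
    (fun t ht => by linarith [ht.2]) hz hd hcube).not_ge hlong

lemma IsP1Solution.exists_lt_cube_lt (h : IsP1Solution J z) (hb : IsLUB J b) (hb₀ : b ≤ 0)
    (hm : m ∈ J) (hd : deriv z m = 0) (N : ℝ) :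
    ∃ p ∈ J, N < z p ∧ 0 < deriv z p ∧ z p ^ 3 < deriv z p ^ 2 := by
  obtain ⟨p, hpmem, hN⟩ := h.exists_Ico_lt hb hb₀ hm (max N (2 * |z m|))
  obtain ⟨hNp, hzp⟩ := max_lt_iff.1 hN
  have hsub : Icc m p ⊆ J ∩ Iic 0 := fun t ht =>
    have htb : t < b := ht.2.trans_lt hpmem.2
    ⟨h.Ico_subset_of_isLUB hb hm ⟨ht.1, htb⟩, htb.le.trans hb₀⟩
  have hp : p ∈ J ∩ Iic 0 := hsub (right_mem_Icc.2 hpmem.1)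
  have hmp : m < p := hpmem.1.lt_of_ne fun e => by
    subst e
    linarith [le_abs_self (z m), abs_nonneg (z m)]
  have hmJ : m ∈ J ∩ Iic 0 := hsub (left_mem_Icc.2 hmp.le)
  refine ⟨p, hp.1, hNp, hd ▸ h.strictMonoOn_deriv hmJ hp hmp, ?_⟩
  exact cube_lt_sq_deriv (z' := deriv z) (f := fun t => 6 * z t ^ 2 - t) hmp.le
    (fun t ht => h.solves.hasDerivAt (hsub ht).1) (fun t ht => (h.solves t (hsub ht).1).2)
    (fun t ht => by linarith [mem_Iic.1 (hsub ht).2])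
    (fun t ht => hd ▸ h.strictMonoOn_deriv.monotoneOn hmJ (hsub ht) ht.1)
    ((by positivity : 0 ≤ 2 * |z m|).trans_lt hzp) (by linarith [le_abs_self (z m)])

lemma eventually_notMem_of_isLUB_lt (h : ∀ m, IsP1Solution (I m) (y m)) (hm : ∀ m, m ∈ I m)
    (hp : ∀ m, phase (y m) m = (yl, 0)) (hb : IsLUB (I c) b) (hbx : b < x₀) (hx₀ : x₀ ≤ 0) :
    ∀ᶠ m in 𝓝 c, x₀ ∉ I m := by
  have hl : 0 < 2 / (x₀ - b) := div_pos two_pos (sub_pos.2 hbx)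
  obtain ⟨p, hpI, hN, hd, hcube⟩ := (h c).exists_lt_cube_lt hb (hbx.le.trans hx₀) (hm c)
    (congrArg Prod.snd (hp c)) ((2 / (x₀ - b)) ^ 2)
  have hopen : IsOpen {Y : ℝ × ℝ | (2 / (x₀ - b)) ^ 2 < Y.1 ∧ 0 < Y.2 ∧ Y.1 ^ 3 < Y.2 ^ 2} :=
    (isOpen_lt continuous_const continuous_fst).and ((isOpen_lt continuous_const continuous_snd).and
      (isOpen_lt (continuous_fst.pow 3) (continuous_snd.pow 2)))
  obtain ⟨hpm, htendsto⟩ := tendsto_phase_of_phase_eq h hm hp hpI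
  filter_upwards [hpm, htendsto (hopen.mem_nhds ⟨hN, hd, hcube⟩)] with m hpm ⟨hN, hd, hcube⟩
  have hpb : p < b := (h c).lt_of_isLUB hb hpI
  have hsqrt : (√(y m p))⁻¹ ≤ (2 / (x₀ - b))⁻¹ := inv_anti₀ hl (Real.le_sqrt_of_sq_le hN.le)
  rw [inv_div] at hsqrt
  exact (h m).notMem_of_cube_le hpm ((sq_nonneg _).trans_lt hN) hd hcube.le hx₀
    (hpb.trans hbx).le (by linarith)

lemma exists_lt_forall_notMem (hx₀ : x₀ ≤ 0) (yl : ℝ) :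
    ∃ m < x₀, ∀ J z, IsP1Solution J z → m ∈ J → phase z m = (yl, 0) → x₀ ∉ J := by
  set M : ℝ := 2 * (|yl| + 4) with hM
  have hM₀ : 0 < M := by positivity
  refine ⟨x₀ - M - 2, by linarith, fun J z h hm hp hx => ?_⟩
  obtain ⟨hy, hd⟩ := Prod.ext_iff.1 hp
  simp only [phase] at hy hd
  have hsub : Icc (x₀ - M - 2) (x₀ - M) ⊆ J := fun t ht =>
    h.ordConnected.out hm hx ⟨ht.1, by linarith [ht.2]⟩
  have hlife : x₀ - M - (x₀ - M - 2) < 1 + 1 :=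
    sub_lt_add_one_of_le_deriv_deriv (z' := deriv z) (f := fun t => 6 * z t ^ 2 - t) one_pos hM₀
      (fun t ht => h.solves.hasDerivAt (hsub ht)) (fun t ht => (h.solves t (hsub ht)).2)
      (fun t ht => by linarith [ht.2]) (fun t ht => by linarith [ht.2, sq_nonneg (z t)])
      hd.ge (by rw [hy, hM]; linarith)
  linarith

theorem exists_isP1Solution_isLUB (hx₀ : x₀ ≤ 0) (yl : ℝ) :
    ∃ J z, IsP1Solution J z ∧ IsLUB J x₀ ∧ IsLeast (z '' J) yl := by
  choose I y h hm hp using fun m : ℝ => exists_isP1Solution m (yl, 0)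
  obtain ⟨m₀, hm₀x, hm₀⟩ := exists_lt_forall_notMem hx₀ yl
  have hne : {m | m < x₀ ∧ x₀ ∉ I m}.Nonempty := ⟨m₀, hm₀x, hm₀ _ _ (h m₀) (hm m₀) (hp m₀)⟩
  obtain ⟨c, hc⟩ : ∃ c, IsLUB {m | m < x₀ ∧ x₀ ∉ I m} c :=
    ⟨_, isLUB_csSup hne ⟨x₀, fun m hm => hm.1.le⟩⟩
  have hx₀c : x₀ ∉ I c := fun hx =>
    have hfreq : ∃ᶠ m in 𝓝 c, m < x₀ ∧ x₀ ∉ I m := (hc.frequently_mem hne).filter_mono inf_le_left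
    have ⟨_, hm', hm''⟩ := (hfreq.and_eventually (tendsto_phase_of_phase_eq h hm hp hx).1).exists
    hm'.2 hm''
  have hcx : c < x₀ := (hc.2 fun m hm => hm.1.le).lt_of_ne fun e => hx₀c (e ▸ hm c)
  obtain ⟨b, hbx, hb⟩ := (h c).exists_isLUB_of_notMem (hm c) hx₀c hcx
  obtain rfl : b = x₀ := by
    by_contra hne
    obtain ⟨m, hcm, hmx, hm'⟩ := ((eventually_lt_nhds hcx).and
      (eventually_notMem_of_isLUB_lt h hm hp hb (hbx.lt_of_ne hne) hx₀)).exists_gt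
    exact (hc.1 ⟨hmx, hm'⟩).not_gt hcm
  exact ⟨I c, y c, h c, hb, (h c).isLeast_image (fun x hx => (hb.1 hx).trans hx₀) (hm c) (hp c)⟩

end Existence

section CauchyExistence

open Metric

variable {E : Type*} [NormedAddCommGroup E] [NormedSpace ℂ E] {F : E → E} {e₀ : E} {K : NNReal}
  {M R r : ℝ} {c : ℂ}

lemma exists_primitive_mapsTo_closedBall [CompleteSpace E] (hF : Differentiable ℂ F)
    (hM : ∀ e ∈ closedBall e₀ R, ‖F e‖ ≤ M) (hr : 0 < r) (hMr : M * r ≤ R)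
    {g : ℂ → E} (hg : DifferentiableOn ℂ g (ball c r))
    (hgR : MapsTo g (ball c r) (closedBall e₀ R)) :
    ∃ G : ℂ → E, G c = e₀ ∧ MapsTo G (ball c r) (closedBall e₀ R) ∧
      ∀ z ∈ ball c r, HasDerivAt G (F (g z)) z := by
  obtain ⟨G, hG₀, hG⟩ := (hF.comp_differentiableOn hg).isExactOn_ball.with_val_at c e₀
  refine ⟨G, hG₀, fun z hz => ?_, hG⟩
  have hbound := (convex_ball c r).norm_image_sub_le_of_norm_hasDerivWithin_le
    (fun x hx => (hG x hx).hasDerivWithinAt) (fun x hx => hM _ (hgR hx)) (mem_ball_self hr) hz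
  rw [hG₀, ← dist_eq_norm, ← dist_eq_norm] at hbound
  have hM₀ : 0 ≤ M := (norm_nonneg _).trans (hM _ (hgR hz))
  calc dist (G z) e₀ ≤ M * dist z c := hbound
    _ ≤ M * r := by gcongr; exact (mem_ball.1 hz).le
    _ ≤ R := hMr

/-- A sequence of Picard iterates, on the disc `ball c r`, for the initial value problem
`f' = F ∘ f`, `f c = e₀`, with values in the ball where `F` is controlled. The iterates are linked
by derivatives rather than by integrals, and the zeroth one is not prescribed. -/
structure IsPicardSequence (F : E → E) (e₀ : E) (R : ℝ) (c : ℂ) (r : ℝ) (g : ℕ → ℂ → E) :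
    Prop where
  apply_center : ∀ n, g n c = e₀
  mapsTo : ∀ n, MapsTo (g n) (ball c r) (closedBall e₀ R)
  hasDerivAt : ∀ n, ∀ z ∈ ball c r, HasDerivAt (g (n + 1)) (F (g n z)) z

lemma exists_isPicardSequence [CompleteSpace E] (hF : Differentiable ℂ F) (hR : 0 ≤ R)
    (hM : ∀ e ∈ closedBall e₀ R, ‖F e‖ ≤ M) (hr : 0 < r) (hMr : M * r ≤ R) :
    ∃ g, IsPicardSequence F e₀ R c r g := by
  let X := {g : ℂ → E // DifferentiableOn ℂ g (ball c r) ∧ g c = e₀ ∧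
    MapsTo g (ball c r) (closedBall e₀ R)}
  have step : ∀ g : X, ∃ G : X, ∀ z ∈ ball c r, HasDerivAt G.1 (F (g.1 z)) z := fun g => by
    obtain ⟨G, hG₀, hGR, hG⟩ :=
      exists_primitive_mapsTo_closedBall hF hM hr hMr g.2.1 g.2.2.2
    exact ⟨⟨G, fun z hz => (hG z hz).differentiableAt.differentiableWithinAt, hG₀, hGR⟩, hG⟩
  choose T hT using step
  let g₀ : X := ⟨fun _ => e₀, differentiableOn_const _, rfl, fun _ _ => mem_closedBall_self hR⟩
  refine ⟨fun n => (T^[n] g₀).1, fun n => (T^[n] g₀).2.2.1, fun n => (T^[n] g₀).2.2.2,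
    fun n => ?_⟩
  rw [Function.iterate_succ_apply']
  exact hT _

namespace IsPicardSequence

variable {g : ℕ → ℂ → E}

lemma dist_succ_le (h : IsPicardSequence F e₀ R c r g) (hK : LipschitzOnWith K F (closedBall e₀ R))
    (hKr : K * r ≤ 1 / 2) (n : ℕ) {z : ℂ} (hz : z ∈ ball c r) :
    dist (g n z) (g (n + 1) z) ≤ 2 * R * (1 / 2) ^ n := by
  induction n generalizing z with
  | zero =>
    have h₀ := mem_closedBall.1 (h.mapsTo 0 hz)
    have h₁ := mem_closedBall'.1 (h.mapsTo 1 hz)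
    simpa [two_mul] using (dist_triangle _ e₀ _).trans (add_le_add h₀ h₁)
  | succ n ih =>
    have hr : 0 < r := dist_nonneg.trans_lt hz
    have hbound := (convex_ball c r).norm_image_sub_le_of_norm_hasDerivWithin_le
      (f := fun z => g (n + 1) z - g (n + 2) z) (C := K * (2 * R * (1 / 2) ^ n))
      (fun x hx => ((h.hasDerivAt n x hx).fun_sub (h.hasDerivAt (n + 1) x hx)).hasDerivWithinAt)
      (fun x hx => by
        rw [← dist_eq_norm]
        exact (hK.dist_le_mul _ (h.mapsTo n hx) _ (h.mapsTo (n + 1) hx)).trans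
          (mul_le_mul_of_nonneg_left (ih hx) K.coe_nonneg))
      (mem_ball_self hr) hz
    simp only [h.apply_center, sub_self, sub_zero, ← dist_eq_norm] at hbound
    have hR : 0 ≤ 2 * R * (1 / 2) ^ n := dist_nonneg.trans (ih hz)
    calc dist (g (n + 1) z) (g (n + 2) z) ≤ K * (2 * R * (1 / 2) ^ n) * dist z c := hbound
      _ ≤ K * (2 * R * (1 / 2) ^ n) * r := by gcongr; exact (mem_ball.1 hz).le
      _ = K * r * (2 * R * (1 / 2) ^ n) := by ring
      _ ≤ 1 / 2 * (2 * R * (1 / 2) ^ n) := by gcongr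
      _ = 2 * R * (1 / 2) ^ (n + 1) := by ring

lemma exists_tendstoUniformlyOn [CompleteSpace E] (h : IsPicardSequence F e₀ R c r g)
    (hK : LipschitzOnWith K F (closedBall e₀ R)) (hKr : K * r ≤ 1 / 2) :
    ∃ f : ℂ → E, TendstoUniformlyOn g f atTop (ball c r) := by
  have hdist := fun z (hz : z ∈ ball c r) n => h.dist_succ_le hK hKr n hz
  have hlim : ∀ z, ∃ a, z ∈ ball c r → Tendsto (fun n => g n z) atTop (𝓝 a) := fun z => by
    by_cases hz : z ∈ ball c r
    · obtain ⟨a, ha⟩ := cauchySeq_tendsto_of_complete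
        (cauchySeq_of_le_geometric (1 / 2) (2 * R) (by norm_num) (hdist z hz))
      exact ⟨a, fun _ => ha⟩
    · exact ⟨0, fun hz' => absurd hz' hz⟩
  choose f hf using hlim
  refine ⟨f, Metric.tendstoUniformlyOn_iff.2 fun ε hε => ?_⟩
  have hgeom : Tendsto (fun n : ℕ => 2 * R * (1 / 2) ^ n / (1 - 1 / 2)) atTop (𝓝 0) := by
    simpa using ((tendsto_pow_atTop_nhds_zero_of_lt_one (r := (1 / 2 : ℝ)) (by norm_num)
      (by norm_num)).const_mul (2 * R)).div_const (1 - 1 / 2)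
  filter_upwards [hgeom.eventually_lt_const hε] with n hn z hz
  rw [dist_comm]
  exact (dist_le_of_le_geometric_of_tendsto (1 / 2) (2 * R) (by norm_num) (hdist z hz)
    (hf z hz) n).trans_lt hn

lemma exists_hasDerivAt [CompleteSpace E] (h : IsPicardSequence F e₀ R c r g)
    (hK : LipschitzOnWith K F (closedBall e₀ R)) (hKr : K * r ≤ 1 / 2) (hr : 0 < r) :
    ∃ f : ℂ → E, f c = e₀ ∧ ∀ z ∈ ball c r, HasDerivAt f (F (f z)) z := by
  obtain ⟨f, hf⟩ := h.exists_tendstoUniformlyOn hK hKr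
  have hfR : MapsTo f (ball c r) (closedBall e₀ R) := fun z hz =>
    isClosed_closedBall.mem_of_tendsto (hf.tendsto_at hz)
      (Eventually.of_forall fun n => h.mapsTo n hz)
  have hderiv : TendstoUniformlyOn (fun n => F ∘ g n) (F ∘ f) atTop (ball c r) :=
    hK.uniformContinuousOn.comp_tendstoUniformlyOn_eventually
      (Eventually.of_forall h.mapsTo) hfR hf
  refine ⟨f, tendsto_nhds_unique (hf.tendsto_at (mem_ball_self hr)) ?_, fun z hz => ?_⟩
  · simp only [h.apply_center, tendsto_const_nhds]
  · exact hasDerivAt_of_tendstoLocallyUniformlyOn isOpen_ball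
      hderiv.tendstoLocallyUniformlyOn (Eventually.of_forall h.hasDerivAt)
      (fun x hx => (hf.tendsto_at hx).comp (tendsto_add_atTop_nat 1)) hz

end IsPicardSequence

lemma exists_analyticAt_hasDerivAt [CompleteSpace E] (hF : ContDiff ℂ 1 F) (e₀ : E) (c : ℂ) :
    ∃ f : ℂ → E, AnalyticAt ℂ f c ∧ f c = e₀ ∧ ∀ᶠ z in 𝓝 c, HasDerivAt f (F (f z)) z := by
  obtain ⟨K, N, hN, hKN⟩ := hF.contDiffAt.exists_lipschitzOnWith (x := e₀)
  obtain ⟨R, hR, hRN⟩ := nhds_basis_closedBall.mem_iff.1 hN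
  have hK : LipschitzOnWith K F (closedBall e₀ R) := hKN.mono hRN
  set M : ℝ := ‖F e₀‖ + K * R + 1
  have hM : ∀ e ∈ closedBall e₀ R, ‖F e‖ ≤ M := fun e he => by
    have hlip : ‖F e - F e₀‖ ≤ K * R := by
      rw [← dist_eq_norm]
      exact (hK.dist_le_mul e he e₀ (mem_closedBall_self hR.le)).trans
        (mul_le_mul_of_nonneg_left he K.coe_nonneg)
    linarith [norm_le_norm_add_norm_sub' (F e) (F e₀)]
  have hM₀ : 0 < M := by positivity
  obtain ⟨r, hr, hMr, hKr⟩ : ∃ r : ℝ, 0 < r ∧ M * r ≤ R ∧ K * r ≤ 1 / 2 := by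
    have hK₁ : (0 : ℝ) < K + 1 := by positivity
    refine ⟨min (R / M) (1 / 2 / (K + 1)), by positivity, ?_, ?_⟩
    · exact (le_div_iff₀' hM₀).1 (min_le_left _ _)
    · calc (K : ℝ) * min (R / M) (1 / 2 / (K + 1)) ≤ (K + 1) * (1 / 2 / (K + 1)) := by
            gcongr
            · linarith
            · exact min_le_right _ _
        _ = 1 / 2 := mul_div_cancel₀ _ hK₁.ne'
  obtain ⟨g, hg⟩ := exists_isPicardSequence (c := c) (hF.differentiable one_ne_zero) hR.le hM
    hr hMr
  obtain ⟨f, hf₀, hf⟩ := hg.exists_hasDerivAt hK hKr hr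
  have hball := ball_mem_nhds c hr
  exact ⟨f, DifferentiableOn.analyticAt
    (fun z hz => (hf z hz).differentiableAt.differentiableWithinAt) hball, hf₀,
    eventually_of_mem hball hf⟩

end CauchyExistence

section AnalyticExtension

variable {E : Type*} [NormedAddCommGroup E]

lemma eventuallyEq_nhdsLE_of_hasDerivWithinAt [NormedSpace ℝ E] {F : E → E} {f g : ℝ → E} {b : ℝ}
    (hF : ContDiffAt ℝ 1 F (f b))
    (hf : ∀ᶠ t in 𝓝[≤] b, HasDerivWithinAt f (F (f t)) (Iic b) t)
    (hg : ∀ᶠ t in 𝓝[≤] b, HasDerivWithinAt g (F (g t)) (Iic b) t) (h : f b = g b) :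
    f =ᶠ[𝓝[≤] b] g := by
  obtain ⟨K, N, hN, hK⟩ := hF.exists_lipschitzOnWith
  have mem_of_eq : ∀ u : ℝ → E, (∀ᶠ t in 𝓝[≤] b, HasDerivWithinAt u (F (u t)) (Iic b) t) →
      u b = f b → ∀ᶠ t in 𝓝[≤] b, HasDerivWithinAt u (F (u t)) (Iic b) t ∧ u t ∈ N :=
    fun u hu hub => hu.and <|
      (hu.self_of_nhdsWithin self_mem_Iic).continuousWithinAt.eventually_mem (by rwa [hub])
  obtain ⟨l, hl, hsub⟩ := (mem_nhdsLE_iff_exists_Icc_subset).1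
    ((mem_of_eq f hf rfl).and (mem_of_eq g hg h.symm))
  have eqOn : EqOn f g (Icc l b) := by
    refine ODE_solution_unique_of_mem_Icc_left (v := fun _ => F) (s := fun _ => N)
      (fun _ _ => hK) (fun t ht => ?_) (fun t ht => ?_) (fun t ht => ?_) (fun t ht => ?_)
      (fun t ht => ?_) (fun t ht => ?_) h
    · exact (hsub ht).1.1.continuousWithinAt.mono Icc_subset_Iic_self
    · exact (hsub (Ioc_subset_Icc_self ht)).1.1.mono (Iic_subset_Iic.2 ht.2)
    · exact (hsub (Ioc_subset_Icc_self ht)).1.2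
    · exact (hsub ht).2.1.continuousWithinAt.mono Icc_subset_Iic_self
    · exact (hsub (Ioc_subset_Icc_self ht)).2.1.mono (Iic_subset_Iic.2 ht.2)
    · exact (hsub (Ioc_subset_Icc_self ht)).2.2
  exact eventually_of_mem (Icc_mem_nhdsLE hl) eqOn

lemma eventually_hasDerivWithinAt_update [NormedSpace ℝ E] {F : E → E} {ψ : ℝ → E} {b : ℝ} {e₀ : E}
    (hF : ContinuousAt F e₀) (hψ : ∀ᶠ t in 𝓝[<] b, HasDerivAt ψ (F (ψ t)) t)
    (hψ₀ : Tendsto ψ (𝓝[<] b) (𝓝 e₀)) :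
    ∀ᶠ t in 𝓝[≤] b, HasDerivWithinAt (Function.update ψ b e₀) (F (Function.update ψ b e₀ t))
      (Iic b) t := by
  have update_eq : ∀ t < b, Function.update ψ b e₀ t = ψ t := fun t ht =>
    Function.update_of_ne ht.ne _ _
  have hderiv : ∀ᶠ t in 𝓝[<] b,
      HasDerivAt (Function.update ψ b e₀) (F (Function.update ψ b e₀ t)) t := by
    filter_upwards [hψ, self_mem_nhdsWithin] with t ht htb
    rw [update_eq t htb]
    exact ht.congr_of_eventuallyEq (eventually_of_mem (Iio_mem_nhds htb) update_eq)
  obtain ⟨l, hl, hsub⟩ := (mem_nhdsLT_iff_exists_Ioo_subset).1 hderiv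
  have hend : HasDerivWithinAt (Function.update ψ b e₀) (F e₀) (Iic b) b := by
    refine hasDerivWithinAt_Iic_of_tendsto_deriv (s := Ioo l b)
      (fun t ht => (hsub ht).differentiableAt.differentiableWithinAt)
      (continuousWithinAt_update_same.2 (hψ₀.mono_left ?_)) (Ioo_mem_nhdsLT hl) ?_
    · exact nhdsWithin_mono b fun t ht => ht.1.2
    · refine (hF.tendsto.comp hψ₀).congr' ?_
      filter_upwards [Ioo_mem_nhdsLT hl] with t ht
      rw [(hsub ht).deriv, update_eq t ht.2, Function.comp_apply]
  rw [← Iio_insert, nhdsWithin_insert, eventually_sup, eventually_pure, Iio_insert,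
    Function.update_self]
  exact ⟨hend, hderiv.mono fun t ht => ht.hasDerivWithinAt⟩

lemma exists_analyticAt_eventuallyEq_of_tendsto [NormedSpace ℂ E] [CompleteSpace E] {F : E → E}
    (hF : ContDiff ℂ 1 F) {ψ : ℝ → E} {b : ℝ} {e₀ : E}
    (hψ : ∀ᶠ t in 𝓝[<] b, HasDerivAt ψ (F (ψ t)) t) (hψ₀ : Tendsto ψ (𝓝[<] b) (𝓝 e₀)) :
    ∃ φ : ℝ → E, AnalyticAt ℝ φ b ∧ φ b = e₀ ∧ ψ =ᶠ[𝓝[<] b] φ := by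
  obtain ⟨f, hf, hfb, hfF⟩ := exists_analyticAt_hasDerivAt hF e₀ (b : ℂ)
  have hfR : ∀ᶠ t : ℝ in 𝓝 b, HasDerivAt (fun t : ℝ => f t) (F (f t)) t := by
    filter_upwards [(Complex.continuous_ofReal.tendsto b).eventually hfF] with t ht
    simpa [Function.comp_def] using! ht.scomp t ((hasDerivAt_id t).ofReal_comp)
  have heq := eventuallyEq_nhdsLE_of_hasDerivWithinAt (hF.contDiffAt.restrict_scalars ℝ)
    (eventually_hasDerivWithinAt_update hF.continuous.continuousAt hψ hψ₀)
    (eventually_nhdsWithin_of_eventually_nhds (hfR.mono fun t ht => ht.hasDerivWithinAt))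
    (by rw [Function.update_self, hfb])
  refine ⟨fun t => f t, hf.restrictScalars.comp (Complex.ofRealCLM.analyticAt b), hfb, ?_⟩
  filter_upwards [heq.filter_mono (nhdsWithin_mono b Iio_subset_Iic_self), self_mem_nhdsWithin]
    with t ht htb
  rw [← ht, Function.update_of_ne (ne_of_lt htb)]

end AnalyticExtension

section LinearGrowth

open Asymptotics

lemma exists_tendsto_of_deriv_isBigO {E : Type*} [NormedAddCommGroup E] [NormedSpace ℝ E]
    [CompleteSpace E] {v v' : ℝ → E} {b : ℝ} (hv : ∀ᶠ t in 𝓝[<] b, HasDerivAt v (v' t) t)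
    (hv' : v' =O[𝓝[<] b] fun t => ‖v t‖ + 1) : ∃ v₀, Tendsto v (𝓝[<] b) (𝓝 v₀) := by
  obtain ⟨C, hC, hbound⟩ := hv'.exists_nonneg
  obtain ⟨s, hs, hsub⟩ := (mem_nhdsLT_iff_exists_Ico_subset).1 (hv.and hbound.bound)
  have hv's : ∀ t ∈ Ico s b, ‖v' t‖ ≤ C * ‖v t‖ + C := fun t ht => by
    simpa [abs_of_nonneg (add_nonneg (norm_nonneg (v t)) zero_le_one), mul_add] using (hsub ht).2
  set V := gronwallBound ‖v s‖ C C (b - s)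
  have hV : ∀ t ∈ Ico s b, ‖v t‖ ≤ V := fun t ht => by
    have hst : Icc s t ⊆ Ico s b := Icc_subset_Ico_right ht.2
    refine (norm_le_gronwallBound_of_norm_deriv_right_le
      (fun x hx => (hsub (hst hx)).1.continuousAt.continuousWithinAt)
      (fun x hx => (hsub (hst (Ico_subset_Icc_self hx))).1.hasDerivWithinAt) le_rfl
      (fun x hx => hv's x (hst (Ico_subset_Icc_self hx))) t (right_mem_Icc.2 ht.1)).trans ?_
    exact gronwallBound_mono (norm_nonneg _) hC hC (sub_le_sub_right ht.2.le s)
  have hlip : LipschitzOnWith (C * V + C).toNNReal v (Ico s b) :=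
    (convex_Ico s b).lipschitzOnWith_of_nnnorm_hasDerivWithin_le
      (fun x hx => (hsub hx).1.hasDerivWithinAt) fun x hx => by
        rw [← NNReal.coe_le_coe, coe_nnnorm]
        refine ((hv's x hx).trans ?_).trans (Real.le_coe_toNNReal _)
        gcongr
        exact hV x hx
  exact CompleteSpace.complete ((cauchy_nhds.mono nhdsWithin_le_nhds).map_of_le
    hlip.uniformContinuousOn (le_principal_iff.2 (Ico_mem_nhdsLT hs)))

end LinearGrowth

section Pole

open Asymptotics

variable {I : Set ℝ} {y : ℝ → ℝ} {b x : ℝ}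

lemma isRightPole_of_tendsto_atTop {g : ℝ → ℝ} (hb : IsLUB I b) (hg : MeromorphicAt g b)
    (hyg : y =ᶠ[𝓝[<] b] g) (hy : Tendsto y (𝓝[<] b) atTop) : IsRightPole I y b := by
  refine ⟨hb, g, hg, not_le.1 fun hord => ?_, hyg⟩
  obtain ⟨l, hl⟩ := tendsto_nhds_of_meromorphicOrderAt_nonneg hg hord
  have hgl : Tendsto g (𝓝[<] b) (𝓝 l) := hl.mono_left (nhdsWithin_mono b fun t ht => ne_of_lt ht)
  exact not_tendsto_atTop_of_tendsto_nhds hgl (hy.congr' hyg)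

/-- The bounded quantity `(2y² - y' √y) / 2`, expressed through the coordinates `(x, u, v)` of
`poleCurve`. -/
def poleFactor {k : Type*} [Field k] (X : k × k × k) : k :=
  X.1 / 4 + X.2.1 / 4 + X.2.2 * X.2.1 ^ 2 / 2

/-- The first Painlevé equation as an autonomous system in the coordinates of `poleCurve`. It is
regular on the polar line `u = 0`, which its solutions cross transversally. The field `k` is `ℝ` or
`ℂ`. -/
def poleField {k : Type*} [Field k] (X : k × k × k) : k × k × k :=
  (1, 1 - X.2.1 ^ 4 * poleFactor X,
    X.2.1 * poleFactor X * (3 * X.2.2 * X.2.1 ^ 2 + X.1 / 2 + X.2.1))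

/-- The curve `(x, u, v)` where `y = u⁻²`, `u < 0` and
`y' = -2 u⁻³ + x u / 2 + u² / 2 + v u³`. The expansion is that of a solution near a pole, where
`v` is the free parameter. -/
noncomputable def poleCurve (y : ℝ → ℝ) (x : ℝ) : ℝ × ℝ × ℝ :=
  (x, -(√(y x))⁻¹,
    2 * √(y x) ^ 6 - x * √(y x) ^ 2 / 2 + √(y x) / 2 - √(y x) ^ 3 * deriv y x)

lemma contDiff_poleField : ContDiff ℂ 1 (poleField (k := ℂ)) := by
  unfold poleField poleFactor
  fun_prop

lemma poleFactor_poleCurve (hy : 0 < y x) :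
    poleFactor (poleCurve y x) = √(y x) ^ 4 - √(y x) * deriv y x / 2 := by
  have hσ := (Real.sqrt_pos.2 hy).ne'
  simp only [poleFactor, poleCurve]
  field_simp
  ring

lemma SolvesP1On.hasDerivAt_poleCurve (h : SolvesP1On I y) (hx : x ∈ I) (hy : 0 < y x) :
    HasDerivAt (poleCurve y) (poleField (poleCurve y x)) x := by
  have hσ₀ := (Real.sqrt_pos.2 hy).ne'
  have hσ := (h.hasDerivAt hx).sqrt hy.ne'
  have hw := (h x hx).2
  rw [← Real.sq_sqrt hy.le] at hw
  refine (hasDerivAt_id' x).prodMk (HasDerivAt.prodMk ?_ ?_)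
  · convert! (hσ.fun_inv hσ₀).fun_neg using 1
    rw [poleFactor_poleCurve hy]
    simp only [poleCurve]
    field_simp
    ring
  · convert! ((((hσ.fun_pow 6).const_mul 2).fun_sub
      (((hasDerivAt_id' x).fun_mul (hσ.fun_pow 2)).div_const 2)).fun_add
      (hσ.div_const 2)).fun_sub ((hσ.fun_pow 3).fun_mul hw) using 1
    rw [poleFactor_poleCurve hy]
    simp only [poleCurve]
    push_cast
    field_simp
    ring

lemma exists_analyticAt_of_hasDerivAt_poleField {X : ℝ → ℝ × ℝ × ℝ} {e₀ : ℝ × ℝ × ℝ}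
    (hX : ∀ᶠ t in 𝓝[<] b, HasDerivAt X (poleField (X t)) t) (hX₀ : Tendsto X (𝓝[<] b) (𝓝 e₀)) :
    ∃ φ : ℝ → ℝ × ℝ × ℝ, AnalyticAt ℝ φ b ∧ X =ᶠ[𝓝[<] b] φ := by
  let ι : ℝ × ℝ × ℝ →L[ℝ] ℂ × ℂ × ℂ :=
    Complex.ofRealCLM.prodMap (Complex.ofRealCLM.prodMap Complex.ofRealCLM)
  let π : ℂ × ℂ × ℂ →L[ℝ] ℝ × ℝ × ℝ :=
    Complex.reCLM.prodMap (Complex.reCLM.prodMap Complex.reCLM)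
  have poleField_comp : ∀ e, poleField (ι e) = ι (poleField e) := fun e => by
    simp [ι, poleField, poleFactor]
  obtain ⟨φ, hφ, -, hXφ⟩ := exists_analyticAt_eventuallyEq_of_tendsto (ψ := ι ∘ X)
    contDiff_poleField
    (hX.mono fun t ht => by
      simpa only [Function.comp_apply, poleField_comp] using ι.hasFDerivAt.comp_hasDerivAt t ht)
    ((ι.continuous.tendsto e₀).comp hX₀)
  have leftInverse : ∀ e, π (ι e) = e := fun e => rfl
  exact ⟨π ∘ φ, (π.analyticAt _).comp hφ, hXφ.mono fun t ht => by
    rw [Function.comp_apply, ← ht, Function.comp_apply, leftInverse]⟩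

namespace IsP1Solution

lemma eventually_mem (h : IsP1Solution I y) (hb : IsLUB I b) : ∀ᶠ t in 𝓝[<] b, t ∈ I := by
  obtain ⟨c, hc⟩ := h.isConnected.nonempty
  exact mem_of_superset (Ico_mem_nhdsLT (h.lt_of_isLUB hb hc)) (h.Ico_subset_of_isLUB hb hc)

lemma eventually_one_le_and_deriv_pos (h : IsP1Solution I y) (hb : IsLUB I b) (hb₀ : b ≤ 0) :
    ∀ᶠ t in 𝓝[<] b, t ∈ I ∧ 1 ≤ y t ∧ 0 < deriv y t := by
  obtain ⟨c, hc⟩ := h.isConnected.nonempty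
  have hy := h.tendsto_atTop hb hb₀
  filter_upwards [h.eventually_mem hb, hy.eventually_ge_atTop 1, hy.eventually_gt_atTop (y c),
    Ioo_mem_nhdsLT (h.lt_of_isLUB hb hc)] with t ht hyt hyc htc
  have hprod := h.mul_deriv_pos_of_lt ⟨hc, (htc.1.trans htc.2).le.trans hb₀⟩
    ⟨ht, htc.2.le.trans hb₀⟩ hyc
  exact ⟨ht, hyt, (pos_iff_pos_of_mul_pos hprod).1 (sub_pos.2 htc.1)⟩

lemma isBigO_p1Energy (h : IsP1Solution I y) (hb : IsLUB I b) (hb₀ : b ≤ 0) :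
    p1Energy y =O[𝓝[<] b] y := by
  obtain ⟨s, hs, hsub⟩ :=
    (mem_nhdsLT_iff_exists_Ico_subset).1 (h.eventually_one_le_and_deriv_pos hb hb₀)
  refine IsBigO.of_bound (|p1Energy y s| + (b - s)) (eventually_of_mem (Ico_mem_nhdsLT hs) ?_)
  intro t ht
  have hst : Icc s t ⊆ Ico s b := Icc_subset_Ico_right ht.2
  have hmono : MonotoneOn y (Icc s t) := monotoneOn_of_hasDerivAt_nonneg (convex_Icc s t)
    (fun x hx => h.solves.hasDerivAt (hsub (hst hx)).1) fun x hx => (hsub (hst hx)).2.2.le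
  have hyt := (hsub ht).2.1
  have hdiff : |p1Energy y t - p1Energy y s| ≤ y t * |t - s| :=
    (convex_Icc s t).norm_image_sub_le_of_norm_hasDerivWithin_le
      (fun x hx => (h.solves.hasDerivAt_p1Energy (hsub (hst hx)).1).hasDerivWithinAt)
      (fun x hx => by
        rw [Real.norm_of_nonneg (zero_le_one.trans (hsub (hst hx)).2.1)]
        exact hmono hx (right_mem_Icc.2 ht.1) hx.2)
      (left_mem_Icc.2 ht.1) (right_mem_Icc.2 ht.1)
  rw [abs_of_nonneg (sub_nonneg.2 ht.1)] at hdiff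
  rw [Real.norm_eq_abs, Real.norm_of_nonneg (zero_le_one.trans hyt)]
  calc |p1Energy y t| ≤ |p1Energy y s| * 1 + y t * (t - s) := by
        linarith [abs_sub_abs_le_abs_sub (p1Energy y t) (p1Energy y s)]
    _ ≤ |p1Energy y s| * y t + y t * (b - s) := by
        gcongr
        exact ht.2.le
    _ = (|p1Energy y s| + (b - s)) * y t := by ring

lemma isBigO_poleFactor (h : IsP1Solution I y) (hb : IsLUB I b) (hb₀ : b ≤ 0) :
    (fun t => poleFactor (poleCurve y t)) =O[𝓝[<] b] fun _ => (1 : ℝ) := by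
  have hpos := h.eventually_one_le_and_deriv_pos hb hb₀
  have hnum : (fun t => √(y t) * (t * y t - p1Energy y t)) =O[𝓝[<] b] fun t => √(y t) ^ 3 := by
    have hid : (fun t : ℝ => t) =O[𝓝[<] b] fun _ => (1 : ℝ) :=
      (tendsto_id.mono_left nhdsWithin_le_nhds).isBigO_one ℝ
    refine ((isBigO_refl (fun t => √(y t)) _).mul ((hid.mul (isBigO_refl y _)).sub
      (by simpa using h.isBigO_p1Energy hb hb₀))).congr' EventuallyEq.rfl ?_
    filter_upwards [hpos] with t ht
    rw [one_mul, pow_succ', Real.sq_sqrt (by linarith)]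
  have hden : (fun t => √(y t) ^ 3) =O[𝓝[<] b] fun t => deriv y t + 2 * √(y t) ^ 3 := by
    refine IsBigO.of_bound' (hpos.mono fun t ht => ?_)
    have hσ : 0 ≤ √(y t) ^ 3 := by positivity
    rw [Real.norm_of_nonneg hσ, Real.norm_of_nonneg (by linarith)]
    linarith
  have hinv := hden.inv_rev (hpos.mono fun t ht h0 => by
    have : 0 < √(y t) ^ 3 := pow_pos (Real.sqrt_pos.2 (by linarith)) 3
    exact absurd h0 this.ne')
  refine (hnum.mul hinv).congr' ?_ ?_
  · filter_upwards [hpos] with t ⟨_, hyt, hw⟩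
    have hσ : √(y t) ^ 2 = y t := Real.sq_sqrt (by linarith)
    have hden₀ : 0 < deriv y t + 2 * √(y t) ^ 3 := by positivity
    rw [poleFactor_poleCurve (by linarith), ← div_eq_mul_inv, div_eq_iff hden₀.ne', p1Energy]
    generalize √(y t) = σ at hσ ⊢
    rw [← hσ]
    ring
  · filter_upwards [hpos] with t ⟨_, hyt, _⟩
    exact mul_inv_cancel₀ (pow_pos (Real.sqrt_pos.2 (by linarith)) 3).ne'

lemma tendsto_poleCurve_snd_fst (h : IsP1Solution I y) (hb : IsLUB I b) (hb₀ : b ≤ 0) :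
    Tendsto (fun t => (poleCurve y t).2.1) (𝓝[<] b) (𝓝 0) := by
  simpa [poleCurve] using (tendsto_inv_atTop_zero.comp
    (Real.tendsto_sqrt_atTop.comp (h.tendsto_atTop hb hb₀))).neg

lemma isBigO_poleField_snd_snd (h : IsP1Solution I y) (hb : IsLUB I b) (hb₀ : b ≤ 0) :
    (fun t => (poleField (poleCurve y t)).2.2) =O[𝓝[<] b]
      fun t => ‖(poleCurve y t).2.2‖ + 1 := by
  have hx : (fun t => (poleCurve y t).1 / 2) =O[𝓝[<] b] fun _ => (1 : ℝ) :=
    ((tendsto_id.mono_left nhdsWithin_le_nhds).div_const 2).isBigO_one ℝ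
  have hu := (h.tendsto_poleCurve_snd_fst hb hb₀).isBigO_one ℝ
  have hv : (fun t => (poleCurve y t).2.2) =O[𝓝[<] b] fun t => ‖(poleCurve y t).2.2‖ + 1 :=
    IsBigO.of_bound' (Eventually.of_forall fun t => by
      rw [Real.norm_of_nonneg (r := _ + _) (by positivity)]
      exact le_add_of_nonneg_right zero_le_one)
  have hone : (fun _ => (1 : ℝ)) =O[𝓝[<] b] fun t => ‖(poleCurve y t).2.2‖ + 1 :=
    IsBigO.of_bound' (Eventually.of_forall fun t => by
      rw [norm_one, Real.norm_of_nonneg (by positivity)]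
      exact le_add_of_nonneg_left (norm_nonneg _))
  have hvu : (fun t => 3 * (poleCurve y t).2.2 * (poleCurve y t).2.1 ^ 2) =O[𝓝[<] b]
      fun t => ‖(poleCurve y t).2.2‖ + 1 := by
    simpa using (hv.const_mul_left 3).mul (hu.pow 2)
  simpa [poleField] using! (hu.mul (h.isBigO_poleFactor hb hb₀)).mul
    ((hvu.add (hx.trans hone)).add (hu.trans hone))

lemma eventually_hasDerivAt_poleCurve (h : IsP1Solution I y) (hb : IsLUB I b) (hb₀ : b ≤ 0) :
    ∀ᶠ t in 𝓝[<] b, HasDerivAt (poleCurve y) (poleField (poleCurve y t)) t :=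
  (h.eventually_one_le_and_deriv_pos hb hb₀).mono fun _t ht =>
    h.solves.hasDerivAt_poleCurve ht.1 (zero_lt_one.trans_le ht.2.1)

lemma exists_tendsto_poleCurve (h : IsP1Solution I y) (hb : IsLUB I b) (hb₀ : b ≤ 0) :
    ∃ v₀, Tendsto (poleCurve y) (𝓝[<] b) (𝓝 (b, 0, v₀)) := by
  obtain ⟨v₀, hv₀⟩ := exists_tendsto_of_deriv_isBigO
    ((h.eventually_hasDerivAt_poleCurve hb hb₀).mono fun _t ht => ht.snd.snd)
    (h.isBigO_poleField_snd_snd hb hb₀)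
  exact ⟨v₀, (tendsto_id.mono_left nhdsWithin_le_nhds).prodMk_nhds
    ((h.tendsto_poleCurve_snd_fst hb hb₀).prodMk_nhds hv₀)⟩

lemma isRightPole (h : IsP1Solution I y) (hb : IsLUB I b) (hb₀ : b ≤ 0) : IsRightPole I y b := by
  have hpos := h.eventually_one_le_and_deriv_pos hb hb₀
  obtain ⟨v₀, hv₀⟩ := h.exists_tendsto_poleCurve hb hb₀
  obtain ⟨φ, hφ, hXφ⟩ := exists_analyticAt_of_hasDerivAt_poleField
    (h.eventually_hasDerivAt_poleCurve hb hb₀) hv₀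
  have hu : AnalyticAt ℝ (fun t => (φ t).2.1) b :=
    analyticAt_fst.comp (analyticAt_snd.comp hφ)
  refine isRightPole_of_tendsto_atTop hb (hu.fun_pow 2).meromorphicAt.inv ?_
    (h.tendsto_atTop hb hb₀)
  filter_upwards [hpos, hXφ] with t ht hXt
  rw [Pi.inv_apply, ← hXt]
  simp only [poleCurve, neg_sq, inv_pow, inv_inv]
  exact (Real.sq_sqrt (by linarith)).symm

end IsP1Solution

end Pole

theorem theorem3p1 :
    -- every solution living on the nonpositive semi-axis has a right pole and a minimum value
    (∀ (I : Set ℝ) (y : ℝ → ℝ), IsP1Solution I y → I ⊆ Iic 0 →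
      ∃ x₀ yl : ℝ, x₀ ≤ 0 ∧ IsRightPole I y x₀ ∧ IsLeast (y '' I) yl) ∧
    -- all pairs of a right pole and a minimum value occur
    (∀ x₀ yl : ℝ, x₀ ≤ 0 →
      ∃ (I : Set ℝ) (y : ℝ → ℝ), IsP1Solution I y ∧ I ⊆ Iic 0 ∧
        IsRightPole I y x₀ ∧ IsLeast (y '' I) yl) ∧
    -- the right pole and the minimum value determine the solution
    (∀ (x₀ yl : ℝ) (I₁ I₂ : Set ℝ) (y₁ y₂ : ℝ → ℝ),
      IsP1Solution I₁ y₁ → I₁ ⊆ Iic 0 → IsRightPole I₁ y₁ x₀ → IsLeast (y₁ '' I₁) yl →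
      IsP1Solution I₂ y₂ → I₂ ⊆ Iic 0 → IsRightPole I₂ y₂ x₀ → IsLeast (y₂ '' I₂) yl →
      I₁ = I₂ ∧ EqOn y₁ y₂ I₁) ∧
    -- the minimum value is attained exactly at `𝒳_min(x₀, y_l)`, which is a genuine infimum
    (∀ (x₀ yl : ℝ) (I : Set ℝ) (y : ℝ → ℝ),
      IsP1Solution I y → I ⊆ Iic 0 → IsRightPole I y x₀ → IsLeast (y '' I) yl →
      IsGLB (xminValues x₀ yl) (calXmin x₀ yl) ∧
        {x | x ∈ I ∧ y x = yl} = {calXmin x₀ yl}) := by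
  refine ⟨fun I y h hI => ?_, fun x₀ yl hx₀ => ?_, ?_, ?_⟩
  · obtain ⟨m, hm, hm'⟩ := h.exists_deriv_eq_zero hI
    have hb : IsLUB I (sSup I) := isLUB_csSup ⟨m, hm⟩ ⟨0, hI⟩
    have hb₀ : sSup I ≤ 0 := hb.2 hI
    exact ⟨sSup I, y m, hb₀, h.isRightPole hb hb₀, h.isLeast_image hI hm (Prod.ext rfl hm')⟩
  · obtain ⟨I, y, h, hb, hl⟩ := exists_isP1Solution_isLUB hx₀ yl
    exact ⟨I, y, h, fun x hx => (hb.1 hx).trans hx₀, h.isRightPole hb hx₀, hl⟩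
  · intro x₀ yl I₁ I₂ y₁ y₂ h₁ hI₁ hb₁ hl₁ h₂ _ hb₂ hl₂
    exact h₁.eq_of_isLUB h₂ hb₁.1 hb₂.1 (hb₁.1.2 hI₁) hl₁ hl₂
  · intro x₀ yl I y h hI hb hl
    exact h.isGLB_calXmin hI hb.1 hl
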